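/- Graphs are finite and may have loops and multiple edges; an euler circuit in a graph is a closed walk, taken up to cyclic shifts, that uses every edge exactly once and contains every vertex, and a graph is eulerian if it has an euler circuit. All embeddings are cellular embeddings in surfaces; an embedding is $2$-face-colorable if its faces can be colored with two colors so that the two sides of every edge lie in faces of different colors, and it is bi-eulerian if it has exactly two faces, each bounded by an euler circuit. Let $G$ be an $n$-vertex eulerian graph such that the minimum degree of the underlying simple graph of $G$ (same vertices, with distinct vertices adjacent if and only if they are adjacent in $G$) is at least $(4n+2)/5$. Let $T$ be an euler circuit in $G$. Then there is a $2$-face-colorable orientable embedding of $G$ with $T$ as the unique face of one color and with exactly one face of the other color if $|V(G)|+|E(G)|$ is even, respectively exactly two faces of the other color if $|V(G)|+|E(G)|$ is odd. This embedding has maximum genus among all $2$-face-colorable orientable embeddings of $G$. When $|V(G)|+|E(G)|$ is even, this embedding is an orientable bi-eulerian embedding of $G$ with $T$ as one of its two faces, and it has maximum genus among all orientable embeddings of $G$. -/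

import Mathlib

/-- A graph (loops and multiple edges allowed) with vertex set `V` and set of half-edges `H`:
`inc` is the incidence map and `mate` is a fixed-point-free involution matching the two
half-edges of each edge. -/
structure HGraph (V : Type*) (H : Type*) where
  inc : H → V
  mate : H → H
  mate_mate : ∀ h, mate (mate h) = h
  mate_ne : ∀ h, mate h ≠ h

namespace HGraph

/-- The edge `{h, mate h}` containing the half-edge `h`. -/
def edge {V H : Type*} (G : HGraph V H) (h : H) : Sym2 H := s(h, G.mate h)

/-- The set of edges. -/
def edgeSet {V H : Type*} (G : HGraph V H) : Set (Sym2 H) := Set.range G.edge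

/-- The underlying simple graph: distinct vertices are adjacent when some edge joins them. -/
def underlyingSimple {V H : Type*} (G : HGraph V H) : SimpleGraph V where
  Adj u v := u ≠ v ∧ ∃ h, G.inc h = u ∧ G.inc (G.mate h) = v
  symm := ⟨by
    rintro u v ⟨hne, h, hu, hv⟩
    exact ⟨hne.symm, G.mate h, hv, by rw [G.mate_mate, hu]⟩⟩
  loopless := ⟨fun _ h => h.1 rfl⟩

/-- A closed walk `(v₀ g₁ h₁ v₁ g₂ h₂ ⋯ gₗ hₗ)` of length `l ≥ 1`, up to cyclic shifts, is recorded
by its cyclic sequence `(g₁ g₂ ⋯ gₗ)` of outgoing half-edges; the other entries are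
`hᵢ = mate gᵢ`, `vᵢ = inc hᵢ`.  The condition says that each step starts where the preceding one
ends, cyclically. -/
def IsClosedWalk {V H : Type*} (G : HGraph V H) (C : Cycle H) : Prop :=
  C.Chain (fun g g' => G.inc (G.mate g) = G.inc g')

/-- A circuit is a closed walk with no repeated edges. -/
def IsCircuit {V H : Type*} (G : HGraph V H) (C : Cycle H) : Prop :=
  G.IsClosedWalk C ∧ (C.map G.edge).Nodup

/-- An euler circuit is a circuit containing all edges and all vertices. -/
def IsEulerCircuit {V H : Type*} (G : HGraph V H) (C : Cycle H) : Prop :=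
  G.IsCircuit C ∧ (∀ e ∈ G.edgeSet, e ∈ C.map G.edge) ∧ (∀ v, ∃ g ∈ C, G.inc g = v)

/-- The mate involution as a permutation of the half-edges. -/
def matePerm {V H : Type*} (G : HGraph V H) : Equiv.Perm H :=
  Function.Involutive.toPerm G.mate G.mate_mate

/-- A (cellular) embedding of a graph in an oriented surface, given by its rotation system:
a permutation `rot` of the half-edges which permutes the half-edges at each vertex in a single
cycle. -/
structure OrientedEmbedding {V H : Type*} (G : HGraph V H) where
  rot : Equiv.Perm H
  inc_rot : ∀ h, G.inc (rot h) = G.inc h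
  sameCycle_of_inc_eq : ∀ g h, G.inc g = G.inc h → rot.SameCycle g h

namespace OrientedEmbedding

/-- Face tracing: after leaving a vertex along `g`, one arrives on `mate g`, and the facial walk
continues with the half-edge following `mate g` in the rotation at the vertex reached. -/
def faceTrace {V H : Type*} {G : HGraph V H} (Φ : G.OrientedEmbedding) : Equiv.Perm H :=
  G.matePerm.trans Φ.rot

/-- The faces are the orbits of the face tracing permutation. -/
def Face {V H : Type*} {G : HGraph V H} (Φ : G.OrientedEmbedding) : Type _ :=
  Quotient (Equiv.Perm.SameCycle.setoid Φ.faceTrace)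

/-- The face whose facial walk leaves a vertex along the half-edge `h`.  The two sides of the
edge `{h, mate h}` lie on the faces `faceOf h` and `faceOf (mate h)`. -/
def faceOf {V H : Type*} {G : HGraph V H} (Φ : G.OrientedEmbedding) (h : H) : Φ.Face :=
  Quotient.mk (Equiv.Perm.SameCycle.setoid Φ.faceTrace) h

/-- The closed walk `C` is the facial walk (boundary) of the face `f`: it runs exactly once
through the orbit of the face tracing permutation that constitutes `f`. -/
def IsFacialWalk {V H : Type*} {G : HGraph V H} (Φ : G.OrientedEmbedding)
    (f : Φ.Face) (C : Cycle H) : Prop :=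
  C ≠ Cycle.nil ∧ C.Nodup ∧ C.Chain (fun g g' => Φ.faceTrace g = g') ∧ ∀ h ∈ C, Φ.faceOf h = f

/-- The Euler genus `γ`, defined by Euler's formula `|V| - |E| + |F| = 2 - γ` for connected
graphs. -/
noncomputable def eulerGenus {V H : Type*} {G : HGraph V H} (Φ : G.OrientedEmbedding) : ℤ :=
  2 - ((Nat.card V : ℤ) - (G.edgeSet.ncard : ℤ) + (Nat.card Φ.Face : ℤ))

/-- The genus of the orientable surface: half of the Euler genus (a rational division, so there
is no rounding). -/
noncomputable def genus {V H : Type*} {G : HGraph V H} (Φ : G.OrientedEmbedding) : ℚ :=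
  (Φ.eulerGenus : ℚ) / 2

/-- A proper 2-coloring of the faces: the two sides of each edge have different colors. -/
def IsProperFaceColoring {V H : Type*} {G : HGraph V H} (Φ : G.OrientedEmbedding)
    (col : Φ.Face → Bool) : Prop :=
  ∀ h, col (Φ.faceOf h) ≠ col (Φ.faceOf (G.mate h))

/-- The embedding is 2-face-colorable. -/
def IsTwoFaceColorable {V H : Type*} {G : HGraph V H} (Φ : G.OrientedEmbedding) : Prop :=
  ∃ col : Φ.Face → Bool, Φ.IsProperFaceColoring col

/-- The embedding is bi-eulerian: it has exactly two faces, each bounded by an euler circuit. -/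
def IsBiEulerian {V H : Type*} {G : HGraph V H} (Φ : G.OrientedEmbedding) : Prop :=
  Nat.card Φ.Face = 2 ∧ ∀ f : Φ.Face, ∃ C : Cycle H, Φ.IsFacialWalk f C ∧ G.IsEulerCircuit C

end OrientedEmbedding

end HGraph

/-! Let `X` be the set of visits of the circuit `T`, `c` the passage to the next visit and `v` the
vertex visited. A permutation `σ` of `X` that acts on the visits of each vertex as a single cycle
yields an embedding (`exists_embedding`): `T` bounds one face, and the remaining faces, all of the
other color, are the orbits of `φ = σ * c⁻¹`. Signs of permutations give Euler's formula modulo two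
(`even_card_add_card_face`), so it suffices that `φ` have at most two orbits: parity then fixes
their number and also gives the genus bounds.

To find `σ`, allow several orbits at a vertex (a split vertex), but insist that `φ` have a single
orbit, and minimize the number of orbits of `σ`. If at most one vertex is split, one transposition
repairs it at the cost of a second orbit of `φ` (`IsMinUnifacial.exists_rotation`).

Suppose that `u` and `w` are both split. By minimality, a merge at `u`, which cuts the orbit of `φ`
in two, leaves all visits to `w` on one part; hence, from a suitable start, `φ` makes all visits to
`u` before all visits to `w` (`exists_isSplitPair`). Merging at both vertices creates three faces,
and no vertex can meet all three (`not_three_faces`). So a third vertex with visits both among those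
to `u` and among those to `w` uses only one gap on each side (`left_gap_aux`, `right_gap_aux`).
Every edge is a step of `φ`, so two such adjacent vertices share a gap at `u` or at `w`. All but at
most four common neighbors of `u` and `w` (two if `u` and `w` are adjacent) are of this kind, with
visits next to the ends of such gaps (`exists_exceptional`). The degree bound gives a triangle among
them; its three vertices share one gap, whose ends have room for only two (`not_triangle`). -/

namespace Equiv.Perm

/-! ### Orbit counts and transpositions. -/

variable {X : Type*}

/-- The number of orbits of a permutation, fixed points included. -/
noncomputable def orbitCount (π : Perm X) : ℕ := Nat.card (Quotient (SameCycle.setoid π))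

theorem SameCycle.apply_eq_of_invariant [Finite X] {Y : Sort*} {π : Perm X} {F : X → Y}
    (hF : ∀ a, F (π a) = F a) {a b : X} (h : π.SameCycle a b) : F b = F a := by
  obtain ⟨k, rfl⟩ := h.exists_nat_pow_eq
  clear h
  induction k with
  | zero => rfl
  | succ k ih => rw [pow_succ', mul_apply, hF, ih]

theorem SameCycle.mem_of_invariant [Finite X] {π : Perm X} {S : Set X}
    (hS : ∀ a ∈ S, π a ∈ S) {a b : X} (h : π.SameCycle a b) (ha : a ∈ S) : b ∈ S := by
  obtain ⟨k, rfl⟩ := h.exists_nat_pow_eq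
  clear h
  induction k with
  | zero => exact ha
  | succ k ih => rw [pow_succ', mul_apply]; exact hS _ ih

theorem orbitCount_pos [Finite X] [Nonempty X] (π : Perm X) : 0 < orbitCount π := by
  have : Nonempty (Quotient (SameCycle.setoid π)) :=
    ⟨Quotient.mk _ (Classical.arbitrary X)⟩
  exact Nat.card_pos

theorem sameCycle_of_orbitCount_le_one [Finite X] {π : Perm X} (h : orbitCount π ≤ 1) (x y : X) :
    π.SameCycle x y := by
  have := Finite.card_le_one_iff_subsingleton.1 h
  exact Quotient.exact (Subsingleton.elim (Quotient.mk (SameCycle.setoid π) x) (Quotient.mk _ y))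

theorem orbitCount_le_one_of_sameCycle [Finite X] {π : Perm X} (h : ∀ x y, π.SameCycle x y) :
    orbitCount π ≤ 1 := by
  refine Finite.card_le_one_iff_subsingleton.2 ⟨fun p q => ?_⟩
  induction p using Quotient.inductionOn with | _ a =>
  induction q using Quotient.inductionOn with | _ b =>
  exact Quotient.sound (h a b)

variable [DecidableEq X]

/-- Starting from `x`, the new permutation follows the old orbit until that would return to `x`, and
is then diverted to `y`. -/
theorem sameCycle_swap_mul_of_not_sameCycle [Finite X] {π : Perm X} {x y : X}
    (h : ¬ π.SameCycle x y) : (swap x y * π).SameCycle x y := by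
  have hex : ∃ k, (π ^ (k + 1)) x = x :=
    ⟨orderOf π - 1, by rw [Nat.sub_add_cancel (orderOf_pos π), pow_orderOf_eq_one]; rfl⟩
  classical
  have hk := Nat.find_spec hex
  set k := Nat.find hex with hkdef
  have hlt : ∀ j ≤ k, ((swap x y * π) ^ j) x = (π ^ j) x := by
    intro j hj
    induction j with
    | zero => rfl
    | succ j ih =>
      rw [pow_succ', mul_apply, ih (by omega), mul_apply, ← mul_apply π, ← pow_succ',
        swap_apply_of_ne_of_ne]
      · exact Nat.find_min hex (show j < Nat.find hex by omega)
      · exact fun e => h ⟨(j + 1 : ℕ), by rw [zpow_natCast]; exact e⟩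
  refine ⟨(k + 1 : ℕ), ?_⟩
  rw [zpow_natCast, pow_succ', mul_apply, hlt k le_rfl, mul_apply, ← mul_apply π, ← pow_succ', hk,
    swap_apply_left]

/-- The stretch of the old orbit from `x` to just before `y` closes up under the new permutation,
since the step into `y` is diverted to `x`. -/
theorem not_sameCycle_swap_mul_of_sameCycle [Finite X] {π : Perm X} {x y : X} (hne : x ≠ y)
    (h : π.SameCycle x y) : ¬ (swap x y * π).SameCycle x y := by
  obtain ⟨k₀, hk₀⟩ := h.exists_nat_pow_eq
  classical
  have hex : ∃ k, (π ^ k) x = y := ⟨k₀, hk₀⟩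
  have hk := Nat.find_spec hex
  have hmin := fun j (hj : j < Nat.find hex) => Nat.find_min hex hj
  set k := Nat.find hex with hkdef
  intro hs
  have hpos : 0 < k := by
    rcases Nat.eq_zero_or_pos k with h0 | h0
    · rw [h0] at hk; exact absurd hk hne
    · exact h0
  have := hs.mem_of_invariant (S := {a | ∃ j < k, (π ^ j) x = a}) (by
    rintro _ ⟨j, hj, rfl⟩
    rw [mul_apply, ← mul_apply π, ← pow_succ']
    by_cases hjk : j + 1 = k
    · rw [hjk, hk, swap_apply_right]
      exact ⟨0, hpos, rfl⟩
    · have hy := hmin (j + 1) (by omega)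
      by_cases hx : (π ^ (j + 1)) x = x
      · exfalso
        apply hmin (k - (j + 1)) (by omega)
        have : (π ^ (k - (j + 1))) ((π ^ (j + 1)) x) = y := by
          rw [← mul_apply, ← pow_add, Nat.sub_add_cancel (by omega), hk]
        rwa [hx] at this
      · rw [swap_apply_of_ne_of_ne hx hy]
        exact ⟨j + 1, by omega, rfl⟩) ⟨0, hpos, rfl⟩
  obtain ⟨j, hj, e⟩ := this
  exact hmin j hj e

/-- The old orbits other than that of `y` correspond to the new orbits. Injectivity comes from `F`,
which identifies the orbit of `y` with that of `x` and is constant along new orbits. -/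
theorem orbitCount_swap_mul_add_one [Finite X] {π : Perm X} {x y : X}
    (h : ¬ π.SameCycle x y) : orbitCount (swap x y * π) + 1 = orbitCount π := by
  classical
  have hxy := sameCycle_swap_mul_of_not_sameCycle h
  set π' := swap x y * π with hπ'
  have hle : ∀ a b, π.SameCycle a b → π'.SameCycle a b := by
    intro a b hab
    have : Quotient.mk (SameCycle.setoid π') b = Quotient.mk (SameCycle.setoid π') a := by
      refine hab.apply_eq_of_invariant (F := fun a => Quotient.mk (SameCycle.setoid π') a) ?_
      intro a
      apply Quotient.sound
      change π'.SameCycle (π a) a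
      have h1 : π'.SameCycle a (π' a) := sameCycle_apply_right.2 (SameCycle.refl _ _)
      rw [hπ', mul_apply, ← hπ'] at h1
      by_cases hx : π a = x
      · rw [hx, swap_apply_left] at h1
        rw [hx]; exact hxy.trans h1.symm
      · by_cases hy : π a = y
        · rw [hy, swap_apply_right] at h1
          rw [hy]; exact hxy.symm.trans h1.symm
        · rw [swap_apply_of_ne_of_ne hx hy] at h1; exact h1.symm
    exact (Quotient.exact this).symm
  let q : X → Quotient (SameCycle.setoid π) := Quotient.mk _
  let F : X → Quotient (SameCycle.setoid π) := fun a => if q a = q y then q x else q a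
  have hF : ∀ a, F (π' a) = F a := by
    have hqπ : ∀ a, q (π a) = q a := fun a =>
      Quotient.sound (show π.SameCycle (π a) a from sameCycle_apply_left.2 (SameCycle.refl _ _))
    have hFπ : ∀ a, F (π a) = F a := fun a => by simp only [F, hqπ]
    have hFx : F x = q x := by simp [F]
    have hFy : F y = q x := by simp [F]
    intro a
    rw [← hFπ a, hπ', mul_apply]
    by_cases hx : π a = x
    · rw [hx, swap_apply_left, hFx, hFy]
    · by_cases hy : π a = y
      · rw [hy, swap_apply_right, hFx, hFy]
      · rw [swap_apply_of_ne_of_ne hx hy]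
  have hqxy : q x ≠ q y := fun e => h (Quotient.exact e)
  let g : {p : Quotient (SameCycle.setoid π) // p ≠ q y} → Quotient (SameCycle.setoid π') :=
    fun p => Quotient.map' (s₁ := SameCycle.setoid π) (s₂ := SameCycle.setoid π') id hle p.1
  have hg : Function.Bijective g := by
    constructor
    · rintro ⟨p, hp⟩ ⟨p', hp'⟩ e
      induction p using Quotient.inductionOn with | _ a =>
      induction p' using Quotient.inductionOn with | _ b =>
      have hab : π'.SameCycle a b := Quotient.exact e
      have := hab.apply_eq_of_invariant hF
      simp only [F] at this
      rw [if_neg hp, if_neg hp'] at this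
      exact Subtype.ext this.symm
    · intro p
      induction p using Quotient.inductionOn with | _ a =>
      by_cases ha : q a = q y
      · refine ⟨⟨q x, hqxy⟩, Quotient.sound ?_⟩
        have : π.SameCycle a y := Quotient.exact ha
        exact hxy.trans (hle _ _ this).symm
      · exact ⟨⟨q a, ha⟩, rfl⟩
  have hc := Nat.card_eq_of_bijective g hg
  unfold orbitCount
  rw [← hc]
  have := Set.ncard_add_ncard_compl {q y}
  rw [Set.ncard_singleton] at this
  rw [← this, add_comm]
  rfl

theorem orbitCount_swap_mul [Finite X] {π : Perm X} {x y : X} (hne : x ≠ y)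
    (h : π.SameCycle x y) : orbitCount (swap x y * π) = orbitCount π + 1 := by
  have := orbitCount_swap_mul_add_one (not_sameCycle_swap_mul_of_sameCycle hne h)
  rw [swap_mul_self_mul] at this
  exact this.symm

theorem orbitCount_swap_mul_le [Finite X] (π : Perm X) (x y : X) :
    orbitCount (swap x y * π) ≤ orbitCount π + 1 := by
  by_cases hne : x = y
  · rw [hne, swap_self]
    exact Nat.le_succ _
  · by_cases h : π.SameCycle x y
    · exact (orbitCount_swap_mul hne h).le
    · have := orbitCount_swap_mul_add_one h
      omega

/-- Each transposition flips the sign and changes the orbit count by one. This is the source of all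
parity statements about faces. -/
theorem sign_eq_pow_orbitCount [Fintype X] (π : Perm X) :
    sign π = (-1) ^ (Fintype.card X + orbitCount π) := by
  induction π using swap_induction_on with
  | one =>
    have : orbitCount (1 : Perm X) = Fintype.card X := by
      rw [orbitCount, ← Nat.card_eq_fintype_card]
      refine (Nat.card_eq_of_bijective (Quotient.mk (SameCycle.setoid (1 : Perm X))) ⟨?_, ?_⟩).symm
      · intro a b e
        exact sameCycle_one.1 (Quotient.exact e)
      · exact Quotient.mk_surjective
    rw [this, map_one, ← two_mul, pow_mul]
    simp
  | swap_mul f x y hne ih =>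
    rw [sign_mul, sign_swap hne, ih]
    by_cases h : f.SameCycle x y
    · rw [orbitCount_swap_mul hne h, ← add_assoc, pow_succ, mul_comm]
    · rw [← orbitCount_swap_mul_add_one h, ← add_assoc, pow_succ]
      simp

end Equiv.Perm

namespace Equiv.Perm

variable {X : Type*} [DecidableEq X]

theorem swap_mul_mem_of_notMem {π : Perm X} {S : Set X} (hS : ∀ s ∈ S, π s ∈ S) {x y : X}
    (hx : x ∉ S) (hy : y ∉ S) : ∀ s ∈ S, (swap x y * π) s ∈ S := by
  intro s hs
  have := hS s hs
  rw [mul_apply, swap_apply_of_ne_of_ne (ne_of_mem_of_not_mem this hx)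
    (ne_of_mem_of_not_mem this hy)]
  exact this

theorem swap_mul_mem_of_mem {π : Perm X} {S : Set X} (hS : ∀ s ∈ S, π s ∈ S) {x y : X}
    (hx : x ∈ S) (hy : y ∈ S) : ∀ s ∈ S, (swap x y * π) s ∈ S := by
  intro s hs
  have := hS s hs
  rw [mul_apply, swap_apply_def]
  split_ifs <;> assumption

theorem not_sameCycle_swap_mul_of_not_sameCycle [Finite X] {π : Perm X} {x y z : X}
    (hx : ¬ π.SameCycle x z) (hy : ¬ π.SameCycle y z) : ¬ (swap x y * π).SameCycle x z := by
  intro h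
  have := h.mem_of_invariant (S := {s | π.SameCycle x s ∨ π.SameCycle y s})
    (swap_mul_mem_of_mem (fun s hs => hs.imp sameCycle_apply_right.2 sameCycle_apply_right.2)
      (Or.inl (SameCycle.refl _ _)) (Or.inr (SameCycle.refl _ _))) (Or.inl (SameCycle.refl _ _))
  exact this.elim hx hy

/-- Three orbits of `φ` can be merged into one by two transpositions of chosen representatives
without increasing the number of orbits of `σ`. -/
theorem exists_swap_mul_swap_merging [Finite X] (σ : Perm X) {φ : Perm X} {x y z : X}
    (hxy : ¬ φ.SameCycle x y) (hxz : ¬ φ.SameCycle x z) (hyz : ¬ φ.SameCycle y z) :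
    ∃ p, (p = x ∨ p = y) ∧ orbitCount (swap p z * (swap x y * σ)) ≤ orbitCount σ ∧
      orbitCount (swap p z * (swap x y * φ)) + 2 = orbitCount φ := by
  have h1 := orbitCount_swap_mul_add_one hxy
  have hne : x ≠ y := fun e => hxy (e ▸ SameCycle.refl _ _)
  have hx := orbitCount_swap_mul_add_one (not_sameCycle_swap_mul_of_not_sameCycle hxz hyz)
  have hy := orbitCount_swap_mul_add_one (not_sameCycle_swap_mul_of_not_sameCycle hyz hxz)
  rw [swap_comm y x] at hy
  -- If `x` and `y` share an orbit of `σ`, the first transposition splits it, and `p` is whichever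
  -- of them is then away from `z`, so that the second one merges. Otherwise the first one merges
  -- and the second at worst splits.
  by_cases hσ : σ.SameCycle x y
  · have h2 := orbitCount_swap_mul hne hσ
    have h3 := not_sameCycle_swap_mul_of_sameCycle hne hσ
    by_cases h4 : (swap x y * σ).SameCycle x z
    · have h5 : ¬ (swap x y * σ).SameCycle y z := fun h => h3 (h4.trans h.symm)
      have := orbitCount_swap_mul_add_one h5
      exact ⟨y, Or.inr rfl, by omega, by omega⟩
    · have := orbitCount_swap_mul_add_one h4
      exact ⟨x, Or.inl rfl, by omega, by omega⟩
  · have h2 := orbitCount_swap_mul_add_one hσ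
    have := orbitCount_swap_mul_le (swap x y * σ) x z
    exact ⟨x, Or.inl rfl, by omega, by omega⟩

end Equiv.Perm

/-! ### Minimal unifacial permutations of the visits. -/

section

open Equiv Equiv.Perm

/-- For a closed walk with set of steps `X`, successor permutation `c` and vertex map `v`,
`σ` respects the vertices and `σ * c⁻¹` has a single orbit. -/
structure IsUnifacial {X V : Type*} (v : X → V) (c σ : Perm X) : Prop where
  map_eq : ∀ x, v (σ x) = v x
  orbitCount_le : orbitCount (σ * c⁻¹) ≤ 1

/-- A unifacial permutation with the least possible number of orbits. -/
structure IsMinUnifacial {X V : Type*} (v : X → V) (c σ : Perm X) : Prop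
    extends IsUnifacial v c σ where
  min : ∀ σ', IsUnifacial v c σ' → orbitCount σ ≤ orbitCount σ'

section

variable {X V : Type*} {v : X → V} {c σ : Perm X}

theorem map_swap_mul_apply [DecidableEq X] {a b : X} (hab : v a = v b)
    (hσ : ∀ x, v (σ x) = v x) (x : X) : v ((swap a b * σ) x) = v x := by
  rw [mul_apply, swap_apply_def]
  split_ifs with h1 h2
  · rw [← hab, ← h1, hσ]
  · rw [hab, ← h2, hσ]
  · exact hσ x

variable [Finite X]

/-- The identity is a candidate, because `c⁻¹` has a single orbit. -/
theorem exists_isMinUnifacial (v : X → V) (hc : ∀ x y, c.SameCycle x y) :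
    ∃ σ, IsMinUnifacial v c σ := by
  have h1 : IsUnifacial v c 1 := ⟨fun _ => rfl, by
    rw [one_mul]
    exact orbitCount_le_one_of_sameCycle fun x y => sameCycle_inv.2 (hc x y)⟩
  obtain ⟨σ, hσ, hmin⟩ := exists_minimalFor_of_wellFoundedLT (IsUnifacial v c) orbitCount ⟨1, h1⟩
  exact ⟨σ, hσ, fun σ' h' => (le_total _ _).elim id fun h => hmin h' h⟩

theorem IsMinUnifacial.sameCycle (h : IsMinUnifacial v c σ) (x y : X) :
    (σ * c⁻¹).SameCycle x y :=
  sameCycle_of_orbitCount_le_one h.orbitCount_le x y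

variable [DecidableEq X]

/-- A transposition of two visits to one vertex does not touch the orbits at the other vertices. -/
theorem sameCycle_of_sameCycle_swap_mul {a b : X} (hab : v a = v b) (hσ : ∀ x, v (σ x) = v x)
    {x y : X} (hx : v x ≠ v a) (h : (swap a b * σ).SameCycle x y) : σ.SameCycle x y := by
  have := h.mem_of_invariant (S := {s | σ.SameCycle x s ∧ v s = v x}) (by
    rintro s ⟨hs, hv⟩
    refine ⟨?_, by rw [map_swap_mul_apply hab hσ, hv]⟩
    rw [mul_apply, swap_apply_of_ne_of_ne]
    · exact sameCycle_apply_right.2 hs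
    · intro e; apply hx; rw [← hv, ← hσ, e]
    · intro e; apply hx; rw [← hv, ← hσ, e, hab]) ⟨SameCycle.refl _ _, rfl⟩
  exact this.1

namespace IsMinUnifacial

variable (h : IsMinUnifacial v c σ)
include h

theorem orbitCount_swap_mul_face {a b : X} (hσ : ¬ σ.SameCycle a b) :
    orbitCount (swap a b * (σ * c⁻¹)) = orbitCount (σ * c⁻¹) + 1 :=
  orbitCount_swap_mul (fun e => hσ (e ▸ SameCycle.refl _ _)) (h.sameCycle a b)

/-- Otherwise transposing `x` and `y` would merge the two faces back into one and also lower the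
orbit count a second time, against minimality. -/
theorem sameCycle_swap_mul {a b x y : X} (hab : v a = v b) (hσ : ¬ σ.SameCycle a b)
    (hxy : v x = v y) (hφ : ¬ (swap a b * (σ * c⁻¹)).SameCycle x y) :
    (swap a b * σ).SameCycle x y := by
  by_contra hcon
  have h1 := orbitCount_swap_mul_add_one hσ
  have h2 := orbitCount_swap_mul_add_one hcon
  have h3 := h.orbitCount_swap_mul_face hσ
  have h4 := orbitCount_swap_mul_add_one hφ
  have h5 := h.orbitCount_le
  have := h.min (swap x y * (swap a b * σ))
    ⟨map_swap_mul_apply hxy (map_swap_mul_apply hab h.map_eq), by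
      rw [mul_assoc, mul_assoc]; omega⟩
  omega

/-- If merging at one vertex leaves two faces which both meet the vertex of `x`, then that vertex
is in a single orbit. -/
theorem sameCycle_swap_mul_of_meets {a b x y t s : X} (hab : v a = v b)
    (hσ : ¬ σ.SameCycle a b) (hxy : v x = v y)
    (hφ : ¬ (swap a b * (σ * c⁻¹)).SameCycle x y) (ht : v t = v x) (hs : v s = v x) :
    (swap a b * σ).SameCycle t s := by
  have key : ∀ t, v t = v x → (swap a b * σ).SameCycle x t := by
    intro t ht
    by_cases h1 : (swap a b * (σ * c⁻¹)).SameCycle x t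
    -- Since `x` and `y` lie on different faces, `t` avoids the face of one of them, and that one is
    -- linked to `t`.
    · have h2 : ¬ (swap a b * (σ * c⁻¹)).SameCycle y t := fun e => hφ (h1.trans e.symm)
      exact (h.sameCycle_swap_mul hab hσ hxy hφ).trans
        (h.sameCycle_swap_mul hab hσ (hxy.symm.trans ht.symm) h2)
    · exact h.sameCycle_swap_mul hab hσ ht.symm h1
  exact (key t ht).symm.trans (key s hs)

/-- If the vertex of `t` met both faces, its visits would form one orbit after the merge at `v a`;
but that merge leaves it split. -/
theorem sameCycle_face_of_ne {a b t s x y : X} (hab : v a = v b) (hσ : ¬ σ.SameCycle a b)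
    (hts : v t = v s) (hσ' : ¬ σ.SameCycle t s) (hne : v t ≠ v a) (hx : v x = v t)
    (hy : v y = v t) : (swap a b * (σ * c⁻¹)).SameCycle x y := by
  by_contra hcon
  have := h.sameCycle_swap_mul_of_meets (t := t) (s := s) hab hσ (hx.trans hy.symm) hcon hx.symm
    (hts.symm.trans hx.symm)
  exact hσ' (sameCycle_of_sameCycle_swap_mul hab h.map_eq hne this)

/-- The merges at two split vertices save two orbits and leave three faces. Joining the three faces
at a common vertex costs no orbit (`exists_swap_mul_swap_merging`), so the result is unifacial with
two orbits fewer. -/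
theorem not_three_faces {a b s t x y z : X} (hab : v a = v b) (hσ : ¬ σ.SameCycle a b)
    (hst : v s = v t) (hσ' : ¬ σ.SameCycle s t) (hne : v s ≠ v a) (hxy : v x = v y)
    (hxz : v x = v z) (hφxy : ¬ (swap s t * (swap a b * (σ * c⁻¹))).SameCycle x y)
    (hφxz : ¬ (swap s t * (swap a b * (σ * c⁻¹))).SameCycle x z)
    (hφyz : ¬ (swap s t * (swap a b * (σ * c⁻¹))).SameCycle y z) : False := by
  have h1 := orbitCount_swap_mul_add_one hσ
  have h2 := orbitCount_swap_mul_add_one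
    (fun e => hσ' (sameCycle_of_sameCycle_swap_mul hab h.map_eq hne e))
  have h3 := h.orbitCount_swap_mul_face hσ
  have h4 := orbitCount_swap_mul (fun e : s = t => hσ' (e.sameCycle σ))
    (h.sameCycle_face_of_ne hab hσ hst hσ' hne rfl hst.symm)
  have h5 := h.orbitCount_le
  obtain ⟨p, hp, h6, h7⟩ :=
    exists_swap_mul_swap_merging (swap s t * (swap a b * σ)) hφxy hφxz hφyz
  have hpz : v p = v z := by rcases hp with rfl | rfl <;> simp_all
  have := h.min (swap p z * (swap x y * (swap s t * (swap a b * σ))))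
    ⟨map_swap_mul_apply hpz (map_swap_mul_apply hxy (map_swap_mul_apply hst
      (map_swap_mul_apply hab h.map_eq))), by
      simp only [mul_assoc] at h7 ⊢; omega⟩
  omega

/-- If at most one vertex is split, there is a proper rotation with at most two faces. -/
theorem exists_rotation
    (hone : ∀ a b s t, v a = v b → ¬ σ.SameCycle a b → v s = v t → ¬ σ.SameCycle s t →
      v s = v a) :
    ∃ ρ : Perm X, (∀ x, v (ρ x) = v x) ∧ (∀ x y, v x = v y → ρ.SameCycle x y) ∧
      orbitCount (ρ * c⁻¹) ≤ 2 := by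
  by_cases hsp : ∃ a b, v a = v b ∧ ¬ σ.SameCycle a b
  · obtain ⟨a, b, hab, hσ⟩ := hsp
    have h3 := h.orbitCount_swap_mul_face hσ
    have h5 := h.orbitCount_le
    refine ⟨swap a b * σ, map_swap_mul_apply hab h.map_eq, fun x y hxy => ?_, by
      rw [mul_assoc]; omega⟩
    by_cases hx : v x = v a
    · refine h.sameCycle_swap_mul_of_meets hab hσ hab ?_ hx (hxy.symm.trans hx)
      exact not_sameCycle_swap_mul_of_sameCycle (fun e => hσ (e ▸ SameCycle.refl _ _))
        (h.sameCycle a b)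
    · have hσxy : σ.SameCycle x y := by
        by_contra hcon
        exact hx (hone a b x y hab hσ hxy hcon)
      -- The same transposition leads back to `σ`, so the invariance of orbits away from `v a` can
      -- be applied in reverse.
      have h' : σ = swap a b * (swap a b * σ) := (swap_mul_self_mul _ _ _).symm
      rw [h'] at hσxy
      exact sameCycle_of_sameCycle_swap_mul hab (map_swap_mul_apply hab h.map_eq) hx hσxy
  · push Not at hsp
    exact ⟨σ, h.map_eq, hsp, h.orbitCount_le.trans (by norm_num)⟩

end IsMinUnifacial

end

/-! ### Positions along the single face, and pairs of split vertices. -/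

/-- `pos` numbers the elements of `X` in the order in which `φ` runs through them from `e`. -/
structure IsCyclePos {X : Type*} (φ : Perm X) (e : X) (pos : X → ℕ) : Prop where
  pow_pos : ∀ x, (φ ^ pos x) e = x
  le : ∀ k x, (φ ^ k) e = x → pos x ≤ k

theorem exists_isCyclePos {X : Type*} [Finite X] {φ : Perm X} (hφ : ∀ x y, φ.SameCycle x y)
    (e : X) : ∃ pos, IsCyclePos φ e pos := by
  classical
  exact ⟨fun x => Nat.find (hφ e x).exists_nat_pow_eq,
    fun x => Nat.find_spec (hφ e x).exists_nat_pow_eq, fun k x hk => Nat.find_min' _ hk⟩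

namespace IsCyclePos

variable {X : Type*} {φ : Perm X} {e : X} {pos : X → ℕ} (h : IsCyclePos φ e pos)
include h

theorem inj {x y : X} (hxy : pos x = pos y) : x = y := by
  rw [← h.pow_pos x, hxy, h.pow_pos]

theorem pos_base : pos e = 0 := Nat.le_zero.1 (h.le 0 e rfl)

theorem pos_pos {x : X} (hx : x ≠ e) : 0 < pos x := by
  rcases Nat.eq_zero_or_pos (pos x) with h0 | h0
  · exact absurd (h.inj (h0.trans h.pos_base.symm)) hx
  · exact h0

theorem pos_apply {x : X} (hx : φ x ≠ e) : pos (φ x) = pos x + 1 := by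
  apply le_antisymm
  · exact h.le _ _ (by rw [pow_succ', mul_apply, h.pow_pos])
  · obtain ⟨j, hj⟩ := Nat.exists_eq_succ_of_ne_zero (h.pos_pos hx).ne'
    have := h.pow_pos (φ x)
    rw [hj, pow_succ', mul_apply, φ.injective.eq_iff] at this
    have := h.le _ _ this
    omega

theorem le_of_apply_eq {x : X} (hx : φ x = e) (y : X) : pos y ≤ pos x := by
  by_contra hlt
  have h1 : (φ ^ (pos x + 1)) e = e := by rw [pow_succ', mul_apply, h.pow_pos, hx]
  have h2 := h.le (pos y - (pos x + 1)) y (by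
    conv_rhs => rw [← h.pow_pos y]
    conv_rhs => rw [← Nat.sub_add_cancel (show pos x + 1 ≤ pos y by omega), pow_add, mul_apply, h1])
  omega

/-- The step that would reach `b` is diverted to `a`. This interval is the piece cut off from the
face by the merge. -/
theorem swap_mul_mem_Ico [DecidableEq X] {a b : X} (hab : pos a < pos b) :
    ∀ x ∈ {x | pos a ≤ pos x ∧ pos x < pos b},
      (swap a b * φ) x ∈ {x | pos a ≤ pos x ∧ pos x < pos b} := by
  rintro x ⟨h1, h2⟩
  have hx : φ x ≠ e := fun hx => by
    have := h.le_of_apply_eq hx b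
    omega
  have h3 := h.pos_apply hx
  rw [mul_apply, swap_apply_def]
  split_ifs with h4 h5
  · rw [h4] at h3; omega
  · exact ⟨le_rfl, hab⟩
  · have : pos (φ x) ≠ pos b := fun e => h5 (h.inj e)
    exact ⟨by omega, by omega⟩

end IsCyclePos

/-- Two representatives of different orbits at the vertex `p` on either side of `θ`. -/
theorem exists_not_sameCycle_of_pos_lt {X V : Type*} {v : X → V} {σ : Perm X} {pos : X → ℕ}
    {p : V} (hp : ∃ a b, v a = p ∧ v b = p ∧ ¬ σ.SameCycle a b) {θ : ℕ} {l r : X}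
    (hl : v l = p) (hr : v r = p) (hlθ : pos l < θ) (hrθ : θ ≤ pos r) :
    ∃ a b, v a = p ∧ v b = p ∧ pos a < θ ∧ θ ≤ pos b ∧ ¬ σ.SameCycle a b := by
  by_cases hlr : σ.SameCycle l r
  · have ht : ∃ t, v t = p ∧ ¬ σ.SameCycle l t := by
      obtain ⟨a, b, ha, hb, hab⟩ := hp
      by_cases hla : σ.SameCycle l a
      · exact ⟨b, hb, fun e => hab (hla.symm.trans e)⟩
      · exact ⟨a, ha, hla⟩
    obtain ⟨t, ht, hlt⟩ := ht
    rcases lt_or_ge (pos t) θ with h1 | h1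
    · exact ⟨t, r, ht, hr, h1, hrθ, fun e => hlt (hlr.trans e.symm)⟩
    · exact ⟨l, t, hl, ht, hlθ, h1, hlt⟩
  · exact ⟨l, r, hl, hr, hlθ, hrθ, hlr⟩

/-- Two split vertices `u` and `w` of a minimal unifacial permutation, with all visits to `u`
preceding all visits to `w`. -/
structure IsSplitPair {X V : Type*} (v : X → V) (c σ : Perm X) (u w : V) (e : X)
    (pos : X → ℕ) : Prop where
  isMin : IsMinUnifacial v c σ
  isPos : IsCyclePos (σ * c⁻¹) e pos
  map_base : v e = u
  ne : u ≠ w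
  split_left : ∃ a b, v a = u ∧ v b = u ∧ ¬ σ.SameCycle a b
  split_right : ∃ a b, v a = w ∧ v b = w ∧ ¬ σ.SameCycle a b
  lt : ∀ x y, v x = u → v y = w → pos x < pos y

theorem IsMinUnifacial.exists_isSplitPair {X V : Type*} [Finite X] {v : X → V} {c σ : Perm X}
    (h : IsMinUnifacial v c σ) {u w : V} (hne : u ≠ w)
    (hu : ∃ a b, v a = u ∧ v b = u ∧ ¬ σ.SameCycle a b)
    (hw : ∃ a b, v a = w ∧ v b = w ∧ ¬ σ.SameCycle a b) :
    ∃ e pos, IsSplitPair v c σ u w e pos := by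
  classical
  obtain ⟨w₀, w₁, hw₀, hw₁, hww⟩ := id hw
  obtain ⟨u₀, _, hu₀, -, -⟩ := id hu
  -- The numbering starts at the first visit to `u` after `w₀`; hence every visit to `u` precedes
  -- `w₀`.
  have hex : ∃ k, v (((σ * c⁻¹) ^ k) w₀) = u := by
    obtain ⟨k, hk⟩ := (h.sameCycle w₀ u₀).exists_nat_pow_eq
    exact ⟨k, by rw [hk, hu₀]⟩
  obtain ⟨k, hk, hmin⟩ : ∃ k, v (((σ * c⁻¹) ^ k) w₀) = u ∧
      ∀ j < k, v (((σ * c⁻¹) ^ j) w₀) ≠ u :=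
    ⟨Nat.find hex, Nat.find_spec hex, fun j hj => Nat.find_min hex hj⟩
  obtain ⟨e, he⟩ : ∃ e, ((σ * c⁻¹) ^ k) w₀ = e := ⟨_, rfl⟩
  rw [he] at hk
  obtain ⟨pos, hpos⟩ := exists_isCyclePos h.sameCycle e
  have hne' : ∀ x y, v x = u → v y = w → pos x ≠ pos y := by
    intro x y hx hy hxy
    exact hne (hx.symm.trans ((congrArg v (hpos.inj hxy)).trans hy))
  have hlt₀ : ∀ x, v x = u → pos x < pos w₀ := by
    intro x hx
    by_contra hcon
    have hp : 0 < pos w₀ := by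
      have := hne' e w₀ hk hw₀
      rw [hpos.pos_base] at this
      omega
    have hxj : ((σ * c⁻¹) ^ (pos x - pos w₀)) w₀ = x := by
      have : ((σ * c⁻¹) ^ (pos x - pos w₀)) (((σ * c⁻¹) ^ pos w₀) e) = x := by
        rw [← mul_apply, ← pow_add, Nat.sub_add_cancel (by omega), hpos.pow_pos]
      rwa [hpos.pow_pos] at this
    rcases lt_or_ge (pos x - pos w₀) k with hj | hj
    · exact hmin _ hj (by rw [hxj, hx])
    · have := hpos.le (pos x - pos w₀ - k) x (by
        rw [← he, ← mul_apply, ← pow_add, Nat.sub_add_cancel hj, hxj])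
      have := hne' x w₀ hx hw₀
      omega
  refine ⟨e, pos, h, hpos, hk, hne, hu, hw, fun x y hx hy => ?_⟩
  by_contra hcon
  have h1 := hne' x y hx hy
  have h2 := hne' e y hk hy
  rw [hpos.pos_base] at h2
  -- A merge at `u` around the early visit `y` to `w` would cut `y` off from `w₀`, which
  -- `sameCycle_face_of_ne` forbids.
  obtain ⟨a, b, ha, hb, hay, hby, hab⟩ := exists_not_sameCycle_of_pos_lt (pos := pos)
    (θ := pos y) hu hk hx (by rw [hpos.pos_base]; omega) (by omega)
  have h3 := h.sameCycle_face_of_ne (x := y) (y := w₀) (ha.trans hb.symm) hab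
    (hw₀.trans hw₁.symm) hww (by rw [hw₀, ha]; exact hne.symm) (hy.trans hw₀.symm) rfl
  have h4 := hne' b y hb hy
  have h5 := h3.mem_of_invariant (hpos.swap_mul_mem_Ico (by omega)) ⟨by omega, by omega⟩
  have := hlt₀ b hb
  have := h5.2
  omega

/-- A visit between two visits to `u`, if the numbering starts at a visit to `u`. -/
def IsLeftInner {X V : Type*} (v : X → V) (pos : X → ℕ) (u : V) (x : X) : Prop :=
  ∃ r, v r = u ∧ pos x < pos r

/-- A visit between two visits to `w`. -/
def IsRightInner {X V : Type*} (v : X → V) (pos : X → ℕ) (w : V) (x : X) : Prop :=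
  ∃ l r, v l = w ∧ v r = w ∧ pos l < pos x ∧ pos x < pos r

namespace IsSplitPair

variable {X V : Type*} {v : X → V} {c σ : Perm X} {u w : V} {e : X} {pos : X → ℕ}
  (h : IsSplitPair v c σ u w e pos)
include h

theorem pos_ne_left {x y : X} (hx : v x ≠ u) (hy : v y = u) : pos x ≠ pos y :=
  fun hxy => hx ((congrArg v (h.isPos.inj hxy)).trans hy)

theorem pos_ne_right {x y : X} (hx : v x ≠ w) (hy : v y = w) : pos x ≠ pos y :=
  fun hxy => hx ((congrArg v (h.isPos.inj hxy)).trans hy)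

theorem ne_base {x : X} (hx : v x ≠ u) : x ≠ e := fun hxe => hx (hxe ▸ h.map_base)

theorem pos_pos {x : X} (hx : v x ≠ u) : 0 < pos x := h.isPos.pos_pos (h.ne_base hx)

theorem exists_left {x : X} (hxu : v x ≠ u) (hx : IsLeftInner v pos u x) :
    ∃ a b, v a = u ∧ v b = u ∧ pos a < pos x ∧ pos x < pos b ∧ ¬ σ.SameCycle a b := by
  obtain ⟨r, hr, hxr⟩ := hx
  obtain ⟨a, b, ha, hb, h1, h2, h3⟩ := exists_not_sameCycle_of_pos_lt (pos := pos) (θ := pos x)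
    h.split_left h.map_base hr (by rw [h.isPos.pos_base]; exact h.pos_pos hxu) hxr.le
  exact ⟨a, b, ha, hb, h1, lt_of_le_of_ne h2 (h.pos_ne_left hxu hb), h3⟩

theorem exists_right {x : X} (hxw : v x ≠ w) (hx : IsRightInner v pos w x) :
    ∃ a b, v a = w ∧ v b = w ∧ pos a < pos x ∧ pos x < pos b ∧ ¬ σ.SameCycle a b := by
  obtain ⟨l, r, hl, hr, hlx, hxr⟩ := hx
  obtain ⟨a, b, ha, hb, h1, h2, h3⟩ := exists_not_sameCycle_of_pos_lt (pos := pos) (θ := pos x)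
    h.split_right hl hr hlx hxr.le
  exact ⟨a, b, ha, hb, h1, lt_of_le_of_ne h2 (h.pos_ne_right hxw hb), h3⟩

variable [Finite X]

theorem not_three_faces {a b s t x y z : X} (ha : v a = u) (hb : v b = u)
    (hab : ¬ σ.SameCycle a b) (hs : v s = w) (ht : v t = w) (hst : ¬ σ.SameCycle s t)
    (hxy : v x = v y) (hxz : v x = v z) (hax : pos a ≤ pos x) (hxb : pos x < pos b)
    (hsy : pos s ≤ pos y) (hyt : pos y < pos t) (hz : pos a ≤ pos z → pos b ≤ pos z)
    (hz' : pos s ≤ pos z → pos t ≤ pos z) : False := by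
  classical
  have hbs := h.lt b s hb hs
  have hP := h.isPos
  have hI := swap_mul_mem_of_notMem (x := s) (y := t)
    (hP.swap_mul_mem_Ico (show pos a < pos b by omega))
    (by simp only [Set.mem_ofPred_eq]; omega) (by simp only [Set.mem_ofPred_eq]; omega)
  have hJ := swap_mul_mem_of_notMem (x := a) (y := b)
    (hP.swap_mul_mem_Ico (show pos s < pos t by omega))
    (by simp only [Set.mem_ofPred_eq]; omega) (by simp only [Set.mem_ofPred_eq]; omega)
  -- The transpositions commute, so either interval may be regarded as cut off first.
  have hcomm : swap a b * swap s t = swap s t * swap a b := by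
    have hd : [a, b, s, t].Nodup := by
      have hn : ∀ p q : X, pos p ≠ pos q → p ≠ q := fun p q hpq e => hpq (e ▸ rfl)
      have h1 := hn a b (by omega)
      have h2 := hn a s (by omega)
      have h3 := hn a t (by omega)
      have h4 := hn b s (by omega)
      have h5 := hn b t (by omega)
      have h6 := hn s t (by omega)
      simp [h1, h2, h3, h4, h5, h6]
    exact (Equiv.Perm.disjoint_swap_swap hd).commute.eq
  rw [← mul_assoc, hcomm, mul_assoc] at hJ
  refine h.isMin.not_three_faces (ha.trans hb.symm) hab (hs.trans ht.symm) hst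
    (by rw [hs, ha]; exact h.ne.symm) hxy hxz ?_ ?_ ?_
  · intro hsame
    have := hsame.mem_of_invariant hI ⟨hax, hxb⟩
    have := this.2
    omega
  · intro hsame
    have := hsame.mem_of_invariant hI ⟨hax, hxb⟩
    have h1 := this.1
    have h2 := this.2
    omega
  · intro hsame
    have := hsame.mem_of_invariant hJ ⟨hsy, hyt⟩
    have h1 := this.1
    have h2 := this.2
    omega

theorem isLeftInner_or_isRightInner {x y z : X} (hxu : v x ≠ u) (hxw : v x ≠ w)
    (hxy : v x = v y) (hxz : v x = v z) (hx : IsLeftInner v pos u x)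
    (hy : IsRightInner v pos w y) : IsLeftInner v pos u z ∨ IsRightInner v pos w z := by
  by_contra hcon
  obtain ⟨a, b, ha, hb, hax, hxb, hab⟩ := h.exists_left hxu hx
  obtain ⟨s, t, hs, ht, hsy, hyt, hst⟩ := h.exists_right (hxy ▸ hxw) hy
  have h1 := h.pos_ne_right (hxz ▸ hxw) hs
  exact h.not_three_faces ha hb hab hs ht hst hxy hxz hax.le hxb hsy.le hyt
    (fun _ => not_lt.1 fun hlt => hcon (Or.inl ⟨b, hb, hlt⟩))
    (fun hle => not_lt.1 fun hlt => hcon (Or.inr ⟨s, t, hs, ht, by omega, hlt⟩))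

/-- If `t` separated `x` from `z`, a merge at `u` could cut off just one of them, leaving the other
on the third face. With `a` before `x`, a visit to `u` between `x` and `z` outside the orbit of `a`
serves as the second end. If neither `b` nor `t` qualifies, `b` lies beyond `z` and `t` is in the
orbit of `a`, so the interval from `t` to `b` cuts off `z`. -/
theorem left_gap_aux {x y z t : X} (hxu : v x ≠ u) (hxw : v x ≠ w) (hxy : v x = v y)
    (hxz : v x = v z) (hx : IsLeftInner v pos u x) (hy : IsRightInner v pos w y)
    (hz : IsLeftInner v pos u z) (ht : v t = u) (hxt : pos x < pos t) : pos z < pos t := by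
  by_contra hzt
  have hzt' := h.pos_ne_left (hxz ▸ hxu) ht
  obtain ⟨a, b, ha, hb, hax, hxb, hab⟩ := h.exists_left hxu hx
  obtain ⟨s, s', hs, hs', hsy, hys, hss⟩ := h.exists_right (hxy ▸ hxw) hy
  obtain ⟨r, hr, hzr⟩ := hz
  have h1 := h.lt r s hr hs
  have h2 := h.lt b s hb hs
  have key : ∀ b', v b' = u → ¬ σ.SameCycle a b' → pos x < pos b' → pos b' < pos z → False :=
    fun b' hb' hab' h3 h4 => h.not_three_faces ha hb' hab' hs hs' hss hxy hxz hax.le h3 hsy.le hys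
      (fun _ => h4.le) (fun _ => by omega)
  have hzb := h.pos_ne_left (hxz ▸ hxu) hb
  by_cases hbz : pos b < pos z
  · exact key b hb hab hxb hbz
  · by_cases hat : σ.SameCycle a t
    · exact h.not_three_faces ht hb (fun e => hab (hat.trans e)) hs hs' hss (hxz.symm.trans hxy)
        hxz.symm (by omega) (by omega) hsy.le hys (fun _ => by omega) (fun _ => by omega)
    · exact key t ht hat hxt (by omega)

theorem right_gap_aux {x y z t : X} (hxu : v x ≠ u) (hxw : v x ≠ w) (hxy : v x = v y)
    (hxz : v x = v z) (hx : IsLeftInner v pos u x) (hy : IsRightInner v pos w y)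
    (hz : IsRightInner v pos w z) (ht : v t = w) (hyt : pos y < pos t) : pos z < pos t := by
  by_contra hzt
  have hzt' := h.pos_ne_right (hxz ▸ hxw) ht
  obtain ⟨s, s', hs, hs', hsx, hxs, hss⟩ := h.exists_left hxu hx
  obtain ⟨a, b, ha, hb, hay, hyb, hab⟩ := h.exists_right (hxy ▸ hxw) hy
  obtain ⟨l, r, hl, hr, hlz, hzr⟩ := hz
  have h1 := h.lt s' l hs' hl
  have h2 := h.lt s' a hs' ha
  have key : ∀ b', v b' = w → ¬ σ.SameCycle a b' → pos y < pos b' → pos b' < pos z → False :=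
    fun b' hb' hab' h3 h4 => h.not_three_faces hs hs' hss ha hb' hab' hxy hxz hsx.le hxs hay.le h3
      (fun _ => by omega) (fun _ => h4.le)
  have hzb := h.pos_ne_right (hxz ▸ hxw) hb
  by_cases hbz : pos b < pos z
  · exact key b hb hab hyb hbz
  · by_cases hat : σ.SameCycle a t
    · exact h.not_three_faces hs hs' hss ht hb (fun e => hab (hat.trans e)) hxz
        hxy hsx.le hxs (by omega) (by omega) (fun _ => by omega) (fun _ => by omega)
    · exact key t ht hat hyt (by omega)

end IsSplitPair

section Gaps

variable {X V : Type*} (v : X → V) (pos : X → ℕ) (p : V)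

/-- The visits `x` and `y` lie in the same gap between visits to `p`. -/
def SameGap (x y : X) : Prop := ∀ t, v t = p → (pos x < pos t ↔ pos y < pos t)

/-- The visit `x` is next to a visit to `p`. -/
def IsNextTo (x : X) : Prop := ∃ y, v y = p ∧ (pos x = pos y + 1 ∨ pos y = pos x + 1)

variable {v pos p}

theorem SameGap.symm {x y : X} (h : SameGap v pos p x y) : SameGap v pos p y x :=
  fun t ht => (h t ht).symm

theorem SameGap.trans {x y z : X} (h : SameGap v pos p x y) (h' : SameGap v pos p y z) :
    SameGap v pos p x z :=
  fun t ht => (h t ht).trans (h' t ht)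

/-- A gap contains at most two vertices next to its ends. -/
theorem SameGap.not_three (hinj : Function.Injective pos) {x y z : X}
    (hxy : SameGap v pos p x y) (hyz : SameGap v pos p y z) (hx : IsNextTo v pos p x)
    (hy : IsNextTo v pos p y) (hz : IsNextTo v pos p z) (hxp : v x ≠ p) (hyp : v y ≠ p)
    (hzp : v z ≠ p) (hvxy : v x ≠ v y) (hvxz : v x ≠ v z) (hvyz : v y ≠ v z) : False := by
  have hne : ∀ {x t}, v x ≠ p → v t = p → pos x ≠ pos t :=
    fun hx ht e => hx ((congrArg v (hinj e)).trans ht)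
  have hneq : ∀ {x y}, v x ≠ v y → pos x ≠ pos y := fun hxy e => hxy (congrArg v (hinj e))
  obtain ⟨a, ha, hax⟩ := hx
  obtain ⟨b, hb, hby⟩ := hy
  obtain ⟨d, hd, hdz⟩ := hz
  have := hneq hvxy
  have := hneq hvxz
  have := hneq hvyz
  have := hxy a ha
  have := hxy b hb
  have := hxy d hd
  have := hyz a ha
  have := hyz b hb
  have := hyz d hd
  have := hne hxp ha
  have := hne hxp hb
  have := hne hxp hd
  have := hne hyp ha
  have := hne hyp hb
  have := hne hyp hd
  have := hne hzp ha
  have := hne hzp hb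
  have := hne hzp hd
  -- In a common gap each visit comes right after the left end or right before the right end, so
  -- three distinct positions do not fit.
  omega

end Gaps

namespace IsSplitPair

variable {X V : Type*} {v : X → V} {c σ : Perm X} {u w : V} {e : X} {pos : X → ℕ}

/-- The vertex `z` has a visit next to `u` and between visits to `u`, and similarly for `w`. -/
def _root_.IsDoublyInner (v : X → V) (pos : X → ℕ) (u w z : V) : Prop :=
  (∃ x, v x = z ∧ IsLeftInner v pos u x ∧ IsNextTo v pos u x) ∧
    ∃ y, v y = z ∧ IsRightInner v pos w y ∧ IsNextTo v pos w y

/-- Since `σ * c⁻¹` sends `c i` to `σ i`, a visit to `v i`, the other side runs through each step of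
the walk backwards. -/
theorem exists_face_step (hσ : ∀ x, v (σ x) = v x) {A : SimpleGraph V}
    (hA : ∀ p q, A.Adj p q → ∃ i, (v i = p ∧ v (c i) = q) ∨ (v i = q ∧ v (c i) = p))
    {p q : V} (hpq : A.Adj p q) :
    ∃ x, (v x = p ∧ v ((σ * c⁻¹) x) = q) ∨ (v x = q ∧ v ((σ * c⁻¹) x) = p) := by
  obtain ⟨i, hi⟩ := hA p q hpq
  refine ⟨c i, ?_⟩
  rw [mul_apply, Perm.inv_def, symm_apply_apply, hσ]
  tauto

variable (h : IsSplitPair v c σ u w e pos)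
include h

variable [Finite X]

/-- The consecutive visits `s` and `s'` lie on the same side, as a last visit to `u` and a first
visit to `w` would have to fit between them otherwise. Neither is at the vertex that delimits the
gaps there, so they share a gap, and each vertex uses only one gap per side. -/
theorem sameGap_of_step {x y x' y' s : X} (hxu : v x ≠ u) (hxw : v x ≠ w) (hxu' : v x' ≠ u)
    (hxw' : v x' ≠ w) (hxy : v x = v y) (hxy' : v x' = v y') (hx : IsLeftInner v pos u x)
    (hy : IsRightInner v pos w y) (hx' : IsLeftInner v pos u x') (hy' : IsRightInner v pos w y')
    (hs : v s = v x) (hs' : v ((σ * c⁻¹) s) = v x') :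
    SameGap v pos u x x' ∨ SameGap v pos w y y' := by
  have hpos := h.isPos.pos_apply (x := s) (h.ne_base (hs' ▸ hxu'))
  set s' := (σ * c⁻¹) s
  have left : ∀ {x y z : X}, v x ≠ u → v x ≠ w → v x = v y → v x = v z →
      IsLeftInner v pos u x → IsRightInner v pos w y → IsLeftInner v pos u z →
      SameGap v pos u x z := fun hxu hxw hxy hxz hx hy hz t ht =>
    ⟨h.left_gap_aux hxu hxw hxy hxz hx hy hz ht,
      h.left_gap_aux (hxz ▸ hxu) (hxz ▸ hxw) (hxz.symm.trans hxy) hxz.symm hz hy hx ht⟩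
  have right : ∀ {x y z : X}, v x ≠ u → v x ≠ w → v x = v y → v x = v z →
      IsLeftInner v pos u x → IsRightInner v pos w y → IsRightInner v pos w z →
      SameGap v pos w y z := fun hxu hxw hxy hxz hx hy hz t ht =>
    ⟨h.right_gap_aux hxu hxw hxy hxz hx hy hz ht,
      h.right_gap_aux hxu hxw hxz hxy hx hz hy ht⟩
  rcases h.isLeftInner_or_isRightInner hxu hxw hxy hs.symm hx hy with hsl | hsr
  · rcases h.isLeftInner_or_isRightInner hxu' hxw' hxy' hs'.symm hx' hy' with hsl' | hsr'
    · left
      refine (left hxu hxw hxy hs.symm hx hy hsl).trans (SameGap.trans (fun t ht => ?_)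
        (left hxu' hxw' hxy' hs'.symm hx' hy' hsl').symm)
      have := h.pos_ne_left (hs' ▸ hxu' : v s' ≠ u) ht
      omega
    · exfalso
      obtain ⟨r, hr, h1⟩ := hsl
      obtain ⟨l, -, hl, -, h2, -⟩ := hsr'
      have := h.lt r l hr hl
      omega
  · rcases h.isLeftInner_or_isRightInner hxu' hxw' hxy' hs'.symm hx' hy' with hsl' | hsr'
    · exfalso
      obtain ⟨r, hr, h1⟩ := hsl'
      obtain ⟨l, -, hl, -, h2, -⟩ := hsr
      have := h.lt r l hr hl
      omega
    · right
      refine (right hxu hxw hxy hs.symm hx hy hsr).trans (SameGap.trans (fun t ht => ?_)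
        (right hxu' hxw' hxy' hs'.symm hx' hy' hsr').symm)
      have := h.pos_ne_right (hs' ▸ hxw' : v s' ≠ w) ht
      omega

/-- Each edge of the triangle gives a shared gap at `u` or at `w`. Two of the three edges agree on
which, so by transitivity all three vertices share that gap, against `SameGap.not_three`. -/
theorem not_triangle {A : SimpleGraph V}
    (hA : ∀ p q, A.Adj p q → ∃ i, (v i = p ∧ v (c i) = q) ∨ (v i = q ∧ v (c i) = p))
    {z₁ z₂ z₃ : V} (h₁ : IsDoublyInner v pos u w z₁) (h₂ : IsDoublyInner v pos u w z₂)
    (h₃ : IsDoublyInner v pos u w z₃) (h₁u : z₁ ≠ u) (h₂u : z₂ ≠ u) (h₃u : z₃ ≠ u)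
    (h₁w : z₁ ≠ w) (h₂w : z₂ ≠ w) (h₃w : z₃ ≠ w) (h₁₂ : A.Adj z₁ z₂) (h₁₃ : A.Adj z₁ z₃)
    (h₂₃ : A.Adj z₂ z₃) : False := by
  obtain ⟨⟨x₁, hx₁, hl₁, hn₁⟩, y₁, hy₁, hr₁, hm₁⟩ := h₁
  obtain ⟨⟨x₂, hx₂, hl₂, hn₂⟩, y₂, hy₂, hr₂, hm₂⟩ := h₂
  obtain ⟨⟨x₃, hx₃, hl₃, hn₃⟩, y₃, hy₃, hr₃, hm₃⟩ := h₃
  have hgap : ∀ {z z' x y x' y'}, z ≠ u → z ≠ w → z' ≠ u → z' ≠ w → v x = z → v y = z →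
      v x' = z' → v y' = z' → IsLeftInner v pos u x → IsRightInner v pos w y →
      IsLeftInner v pos u x' → IsRightInner v pos w y' → A.Adj z z' →
      SameGap v pos u x x' ∨ SameGap v pos w y y' := by
    intro z z' x y x' y' hu hw hu' hw' hx hy hx' hy' hl hr hl' hr' hadj
    subst hx hx'
    obtain ⟨s, hs | hs⟩ := exists_face_step h.isMin.map_eq hA hadj
    · exact h.sameGap_of_step hu hw hu' hw' hy.symm hy'.symm hl hr hl' hr' hs.1 hs.2
    · exact (h.sameGap_of_step hu' hw' hu hw hy'.symm hy.symm hl' hr' hl hr hs.1 hs.2).imp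
        SameGap.symm SameGap.symm
  have hinj : Function.Injective pos := fun _ _ => h.isPos.inj
  have g₁₂ := hgap h₁u h₁w h₂u h₂w hx₁ hy₁ hx₂ hy₂ hl₁ hr₁ hl₂ hr₂ h₁₂
  have g₁₃ := hgap h₁u h₁w h₃u h₃w hx₁ hy₁ hx₃ hy₃ hl₁ hr₁ hl₃ hr₃ h₁₃
  have g₂₃ := hgap h₂u h₂w h₃u h₃w hx₂ hy₂ hx₃ hy₃ hl₂ hr₂ hl₃ hr₃ h₂₃
  have noU : SameGap v pos u x₁ x₂ → SameGap v pos u x₂ x₃ → False := fun p q =>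
    SameGap.not_three hinj p q hn₁ hn₂ hn₃ (hx₁ ▸ h₁u) (hx₂ ▸ h₂u) (hx₃ ▸ h₃u)
      (by rw [hx₁, hx₂]; exact h₁₂.ne) (by rw [hx₁, hx₃]; exact h₁₃.ne)
      (by rw [hx₂, hx₃]; exact h₂₃.ne)
  have noW : SameGap v pos w y₁ y₂ → SameGap v pos w y₂ y₃ → False := fun p q =>
    SameGap.not_three hinj p q hm₁ hm₂ hm₃ (hy₁ ▸ h₁w) (hy₂ ▸ h₂w) (hy₃ ▸ h₃w)
      (by rw [hy₁, hy₂]; exact h₁₂.ne) (by rw [hy₁, hy₃]; exact h₁₃.ne)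
      (by rw [hy₂, hy₃]; exact h₂₃.ne)
  rcases g₁₂ with a | a <;> rcases g₁₃ with b | b <;> rcases g₂₃ with d | d
  · exact noU a d
  · exact noU a (a.symm.trans b)
  · exact noU a d
  · exact noW (b.trans d.symm) d
  · exact noU (b.trans d.symm) d
  · exact noW a d
  · exact noW a (a.symm.trans b)
  · exact noW a d

/-- An edge from `u` to `z` is a step of `φ` and puts `z` next to and among the visits to `u`,
unless the step enters the first visit `e` or leaves the last visit `l`. Likewise for `w`, with
first visit `f` and last visit `g`; this leaves four exceptions. -/
theorem exists_exceptional {A : SimpleGraph V}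
    (hA : ∀ p q, A.Adj p q → ∃ i, (v i = p ∧ v (c i) = q) ∨ (v i = q ∧ v (c i) = p)) :
    ∃ E : Finset V, E.card ≤ 4 ∧ (A.Adj u w → E.card ≤ 2) ∧
      ∀ z, A.Adj u z → A.Adj w z → z ∉ E → IsDoublyInner v pos u w z := by
  classical
  obtain ⟨φ, hφ⟩ : ∃ φ, φ = σ * c⁻¹ := ⟨_, rfl⟩
  have hP := h.isPos
  have hstep := fun {p q} (hpq : A.Adj p q) => exists_face_step h.isMin.map_eq hA hpq
  rw [← hφ] at hP
  simp only [← hφ] at hstep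
  have hinv : ∀ x, φ⁻¹ (φ x) = x := φ.symm_apply_apply
  obtain ⟨l, hl, hlmax⟩ := Set.exists_max_image {x | v x = u} pos (Set.toFinite _) ⟨e, h.map_base⟩
  obtain ⟨w₀, -, hw₀, -, -⟩ := h.split_right
  obtain ⟨f, hf, hfmin⟩ := Set.exists_min_image {x | v x = w} pos (Set.toFinite _) ⟨w₀, hw₀⟩
  obtain ⟨g, hg, hgmax⟩ := Set.exists_max_image {x | v x = w} pos (Set.toFinite _) ⟨w₀, hw₀⟩
  simp only [Set.mem_ofPred_eq] at hl hlmax hf hfmin hg hgmax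
  have core : ∀ z, A.Adj u z → A.Adj w z → IsDoublyInner v pos u w z ∨ z = v (φ⁻¹ e) ∨
      z = v (φ l) ∨ z = v (φ⁻¹ f) ∨ z = v (φ g) := by
    intro z huz hwz
    have hzu : z ≠ u := huz.ne'
    have hzw : z ≠ w := hwz.ne'
    by_contra hcon
    push Not at hcon
    obtain ⟨hcon, h1, h2, h3, h4⟩ := hcon
    apply hcon
    constructor
    · obtain ⟨x, ⟨hx, hx'⟩ | ⟨hx, hx'⟩⟩ := hstep huz
      · have hp := hP.pos_apply (x := x) (h.ne_base (hx' ▸ hzu))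
        refine ⟨φ x, hx', ⟨l, hl, ?_⟩, x, hx, Or.inl hp⟩
        have := hlmax x hx
        have hne : pos x ≠ pos l := fun e' => h2 (by rw [← hP.inj e', hx'])
        have := h.pos_ne_left (hx' ▸ hzu : v (φ x) ≠ u) hl
        omega
      · have hp := hP.pos_apply (x := x) (fun e' => h1 (by rw [← e', hinv, hx]))
        exact ⟨x, hx, ⟨_, hx', by omega⟩, _, hx', Or.inr hp⟩
    · obtain ⟨x, ⟨hx, hx'⟩ | ⟨hx, hx'⟩⟩ := hstep hwz
      · have hp := hP.pos_apply (x := x) (h.ne_base (hx' ▸ hzu))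
        refine ⟨φ x, hx', ⟨x, g, hx, hg, by omega, ?_⟩, x, hx, Or.inl hp⟩
        have := hgmax x hx
        have hne : pos x ≠ pos g := fun e' => h4 (by rw [← hP.inj e', hx'])
        have := h.pos_ne_right (hx' ▸ hzw : v (φ x) ≠ w) hg
        omega
      · have hp := hP.pos_apply (x := x) (h.ne_base (hx' ▸ h.ne.symm))
        refine ⟨x, hx, ⟨f, φ x, hf, hx', ?_, by omega⟩, _, hx', Or.inr hp⟩
        have := hfmin _ hx'
        have hne : pos f ≠ pos (φ x) := fun e' =>
          h3 (by rw [hP.inj e', hinv, hx])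
        have := h.pos_ne_right (hx ▸ hzw : v x ≠ w) hf
        omega
  by_cases huw : A.Adj u w
  -- A step between `u` and `w` can only be from `l` to `f` or from `g` to `e`. Two of the four
  -- exceptions are then `u` and `w` themselves, which are not common neighbors.
  · have hcase : (v (φ l) = w ∧ v (φ⁻¹ f) = u) ∨ (v (φ⁻¹ e) = w ∧ v (φ g) = u) := by
      obtain ⟨x, ⟨hx, hx'⟩ | ⟨hx, hx'⟩⟩ := hstep huw
      · left
        have hp := hP.pos_apply (x := x) (h.ne_base (hx' ▸ h.ne.symm))
        have h1 : x = l := hP.inj (by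
          have := hlmax x hx
          have := h.lt l _ hl hx'
          omega)
        have h2 : φ x = f := hP.inj (by
          have := hfmin _ hx'
          have := h.lt x f hx hf
          omega)
        rw [← h1, ← h2, hinv]
        exact ⟨hx', hx⟩
      · right
        have he : φ x = e := by
          by_contra hne
          have hp := hP.pos_apply (x := x) hne
          have := h.lt _ x hx' hx
          omega
        have h2 : x = g := hP.inj (by
          have := hP.le_of_apply_eq he g
          have := hgmax x hx
          omega)
        rw [← h2, ← he, hinv]
        exact ⟨hx, hx'⟩
    rcases hcase with ⟨p, q⟩ | ⟨p, q⟩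
    · refine ⟨{v (φ⁻¹ e), v (φ g)}, Finset.card_le_two.trans (by norm_num),
        fun _ => Finset.card_le_two, fun z huz hwz hz => ?_⟩
      simp only [Finset.mem_insert, Finset.mem_singleton, not_or] at hz
      have := core z huz hwz
      rw [p, q] at this
      have := huz.ne'
      have := hwz.ne'
      tauto
    · refine ⟨{v (φ l), v (φ⁻¹ f)}, Finset.card_le_two.trans (by norm_num),
        fun _ => Finset.card_le_two, fun z huz hwz hz => ?_⟩
      simp only [Finset.mem_insert, Finset.mem_singleton, not_or] at hz
      have := core z huz hwz
      rw [p, q] at this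
      have := huz.ne'
      have := hwz.ne'
      tauto
  · refine ⟨{v (φ⁻¹ e), v (φ l), v (φ⁻¹ f), v (φ g)}, Finset.card_le_four,
      fun h' => absurd h' huw, fun z huz hwz hz => ?_⟩
    simp only [Finset.mem_insert, Finset.mem_singleton, not_or] at hz
    have := core z huz hwz
    tauto

end IsSplitPair

/-! ### Triangles in dense graphs, and the rotation they provide. -/

/-- In a dense graph, removing few vertices from the common neighbourhood of two vertices leaves
a triangle. -/
theorem SimpleGraph.exists_triangle_commonNeighbors {V : Type*} [Fintype V] [DecidableEq V]
    (A : SimpleGraph V) [DecidableRel A.Adj]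
    (hdeg : 4 * Fintype.card V + 2 ≤ 5 * A.minDegree) {u w : V} (hne : u ≠ w) (E : Finset V)
    (hE : E.card ≤ 4) (hE' : A.Adj u w → E.card ≤ 2) :
    ∃ z₁ z₂ z₃, (∀ z ∈ ({z₁, z₂, z₃} : Finset V), A.Adj u z ∧ A.Adj w z ∧ z ∉ E) ∧
      A.Adj z₁ z₂ ∧ A.Adj z₁ z₃ ∧ A.Adj z₂ z₃ := by
  have hd : ∀ x, A.minDegree ≤ (A.neighborFinset x).card := fun x => by
    rw [A.card_neighborFinset_eq_degree]; exact A.minDegree_le_degree x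
  have hint : ∀ s t : Finset V, s.card + t.card ≤ (s ∩ t).card + Fintype.card V := by
    intro s t
    have := Finset.card_union_add_card_inter s t
    have := Finset.card_le_univ (s ∪ t)
    omega
  have hC : 2 * A.minDegree ≤ (A.neighborFinset u ∩ A.neighborFinset w).card + Fintype.card V ∧
      (¬ A.Adj u w →
        2 * A.minDegree + 2 ≤ (A.neighborFinset u ∩ A.neighborFinset w).card + Fintype.card V) := by
    have h1 := hd u
    have h2 := hd w
    constructor
    · have := hint (A.neighborFinset u) (A.neighborFinset w)
      omega
    -- Nonadjacent `u` and `w` both lie outside the union of their neighborhoods. The gain of two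
    -- offsets the two extra exceptions.
    · intro huw
      have h3 := Finset.card_union_add_card_inter (A.neighborFinset u) (A.neighborFinset w)
      have h4 : (A.neighborFinset u ∪ A.neighborFinset w ∪ {u, w}).card =
          (A.neighborFinset u ∪ A.neighborFinset w).card + 2 := by
        rw [Finset.card_union_of_disjoint, Finset.card_pair hne]
        rw [Finset.disjoint_right]
        have huw' : ¬ A.Adj w u := fun h => huw h.symm
        simp [huw, huw']
      have h5 := Finset.card_le_univ (A.neighborFinset u ∪ A.neighborFinset w ∪ {u, w})
      omega
  obtain ⟨Z, hZ⟩ : ∃ Z, Z = (A.neighborFinset u ∩ A.neighborFinset w) \ E := ⟨_, rfl⟩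
  have hZcard : 2 * A.minDegree ≤ Z.card + Fintype.card V + 2 := by
    have := Finset.le_card_sdiff E (A.neighborFinset u ∩ A.neighborFinset w)
    rw [← hZ] at this
    by_cases huw : A.Adj u w
    · have := hE' huw
      omega
    · have := hC.2 huw
      omega
  -- With `n` vertices and minimum degree `d`, this forces `n ≥ 7`, and the tightest count below, `4
  -- * d - 3 * n - 2`, is positive.
  have hlt : A.minDegree < Fintype.card V := lt_of_le_of_lt (A.minDegree_le_degree u)
    (A.degree_lt_card_verts u)
  have h1 : Z.Nonempty := Finset.card_pos.1 (by omega)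
  obtain ⟨z₁, hz₁⟩ := h1
  have h2 : (A.neighborFinset z₁ ∩ Z).Nonempty := Finset.card_pos.1 (by
    have := hint (A.neighborFinset z₁) Z
    have := hd z₁
    omega)
  obtain ⟨z₂, hz₂⟩ := h2
  have h3 : (A.neighborFinset z₁ ∩ A.neighborFinset z₂ ∩ Z).Nonempty := Finset.card_pos.1 (by
    have := hint (A.neighborFinset z₁ ∩ A.neighborFinset z₂) Z
    have := hint (A.neighborFinset z₁) (A.neighborFinset z₂)
    have := hd z₁
    have := hd z₂
    omega)
  obtain ⟨z₃, hz₃⟩ := h3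
  simp only [hZ, Finset.mem_inter, Finset.mem_sdiff, SimpleGraph.mem_neighborFinset] at hz₁ hz₂ hz₃
  refine ⟨z₁, z₂, z₃, ?_, hz₂.1, hz₃.1.1, hz₃.1.2⟩
  intro z hz
  simp only [Finset.mem_insert, Finset.mem_singleton] at hz
  rcases hz with rfl | rfl | rfl <;> tauto

/-- The dense case: every closed walk spanning a dense graph has a rotation with at most two
faces on the other side. -/
theorem exists_rotation_of_minDegree {X V : Type*} [Finite X] [Fintype V] {v : X → V}
    {c : Perm X} (hc : ∀ x y, c.SameCycle x y) (A : SimpleGraph V) [DecidableRel A.Adj]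
    (hA : ∀ p q, A.Adj p q → ∃ i, (v i = p ∧ v (c i) = q) ∨ (v i = q ∧ v (c i) = p))
    (hdeg : 4 * Fintype.card V + 2 ≤ 5 * A.minDegree) :
    ∃ ρ : Perm X, (∀ x, v (ρ x) = v x) ∧ (∀ x y, v x = v y → ρ.SameCycle x y) ∧
      orbitCount (ρ * c⁻¹) ≤ 2 := by
  classical
  obtain ⟨σ, hσ⟩ := exists_isMinUnifacial v hc
  refine hσ.exists_rotation fun a b s t hab hσab hst hσst => ?_
  by_contra hne
  obtain ⟨e, pos, h⟩ := hσ.exists_isSplitPair (u := v a) (w := v s) (Ne.symm hne)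
    ⟨a, b, rfl, hab.symm, hσab⟩ ⟨s, t, rfl, hst.symm, hσst⟩
  obtain ⟨E, hE, hE', hEz⟩ := h.exists_exceptional hA
  obtain ⟨z₁, z₂, z₃, hz, h₁₂, h₁₃, h₂₃⟩ :=
    A.exists_triangle_commonNeighbors hdeg (Ne.symm hne) E hE hE'
  obtain ⟨a₁, b₁, d₁⟩ := hz z₁ (by simp)
  obtain ⟨a₂, b₂, d₂⟩ := hz z₂ (by simp)
  obtain ⟨a₃, b₃, d₃⟩ := hz z₃ (by simp)
  exact h.not_triangle hA (hEz _ a₁ b₁ d₁) (hEz _ a₂ b₂ d₂) (hEz _ a₃ b₃ d₃) a₁.ne' a₂.ne' a₃.ne'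
    b₁.ne' b₂.ne' b₃.ne' h₁₂ h₁₃ h₂₃

/-! ### Semiconjugate permutations and orbits as cyclic sequences. -/

theorem Equiv.Perm.pow_apply_of_semiconj {X Y : Type*} {φ : Perm X} {ψ : Perm Y} {f : X → Y}
    (hf : ∀ x, ψ (f x) = f (φ x)) (n : ℕ) (x : X) : (ψ ^ n) (f x) = f ((φ ^ n) x) := by
  induction n with
  | zero => rfl
  | succ n ih => rw [pow_succ', mul_apply, ih, hf, pow_succ', mul_apply]

theorem Equiv.Perm.SameCycle.map {X Y : Type*} [Finite X] {φ : Perm X} {ψ : Perm Y} {f : X → Y}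
    (hf : ∀ x, ψ (f x) = f (φ x)) {x y : X} (h : φ.SameCycle x y) :
    ψ.SameCycle (f x) (f y) := by
  obtain ⟨n, rfl⟩ := h.exists_nat_pow_eq
  exact ⟨n, by rw [zpow_natCast, pow_apply_of_semiconj hf]⟩

theorem Equiv.Perm.sameCycle_map_iff {X Y : Type*} [Finite X] [Finite Y] {φ : Perm X}
    {ψ : Perm Y} {f : X → Y} (hinj : Function.Injective f) (hf : ∀ x, ψ (f x) = f (φ x))
    {x y : X} : ψ.SameCycle (f x) (f y) ↔ φ.SameCycle x y := by
  refine ⟨fun h => ?_, SameCycle.map hf⟩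
  obtain ⟨n, hn⟩ := h.exists_nat_pow_eq
  rw [pow_apply_of_semiconj hf] at hn
  exact ⟨n, by rw [zpow_natCast]; exact hinj hn⟩

theorem Cycle.chain_ofFn {α : Type*} {r : α → α → Prop} {k : ℕ} {f : Fin (k + 1) → α} :
    Cycle.Chain r (List.ofFn f : Cycle α) ↔ ∀ i, r (f i) (f (i + 1)) := by
  have h : (List.ofFn f : Cycle α) =
      Cycle.map (fun j : ℕ => f (Fin.ofNat (k + 1) j)) (List.range (k + 1) : Cycle ℕ) := by
    rw [Cycle.map_coe]
    congr 1
    apply List.ext_getElem (by simp)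
    intro i h1 h2
    simp only [List.getElem_ofFn, List.getElem_map, List.getElem_range]
    congr 1
    ext
    simp only [Fin.val_ofNat]
    rw [Nat.mod_eq_of_lt (by simpa using h1)]
  rw [h, Cycle.chain_map, Cycle.chain_range_succ]
  have hk : Fin.ofNat (k + 1) k = Fin.last k := by ext; simp
  constructor
  · rintro ⟨h0, hs⟩ i
    rcases Fin.eq_castSucc_or_eq_last i with ⟨j, rfl⟩ | rfl
    · have := hs j j.2
      convert this using 2
      · ext; simp
      · ext
        rw [Fin.coeSucc_eq_succ, Fin.val_succ, Fin.val_ofNat,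
          Nat.mod_eq_of_lt (Nat.succ_lt_succ j.2)]
    · rw [hk] at h0
      rw [Fin.last_add_one]
      exact h0
  · intro hs
    refine ⟨?_, fun m hm => ?_⟩
    · rw [hk]
      have := hs (Fin.last k)
      rwa [Fin.last_add_one] at this
    · have := hs (Fin.ofNat (k + 1) m)
      convert this using 2
      ext
      simp [Fin.val_add]

/-- The orbit of a point, as a cyclic sequence. -/
theorem Equiv.Perm.exists_cycle_of_orbit {Y : Type*} [Finite Y] (ψ : Perm Y) (y : Y) :
    ∃ C : Cycle Y, C ≠ Cycle.nil ∧ C.Nodup ∧ C.Chain (fun g g' => ψ g = g') ∧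
      ∀ g, g ∈ C ↔ ψ.SameCycle y g := by
  classical
  have hex : ∃ k, (ψ ^ (k + 1)) y = y :=
    ⟨orderOf ψ - 1, by rw [Nat.sub_add_cancel (orderOf_pos ψ), pow_orderOf_eq_one]; rfl⟩
  obtain ⟨k, hk, hmin⟩ : ∃ k, (ψ ^ (k + 1)) y = y ∧ ∀ j < k, (ψ ^ (j + 1)) y ≠ y :=
    ⟨Nat.find hex, Nat.find_spec hex, fun j hj => Nat.find_min hex hj⟩
  have hchain : ∀ i : Fin (k + 1), ψ ((ψ ^ (i : ℕ)) y) = (ψ ^ ((i + 1 : Fin (k + 1)) : ℕ)) y := by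
    intro i
    rw [← mul_apply, ← pow_succ']
    rcases Fin.eq_castSucc_or_eq_last i with ⟨j, rfl⟩ | rfl
    · rw [Fin.coeSucc_eq_succ, Fin.val_succ, Fin.val_castSucc]
    · rw [Fin.last_add_one, Fin.val_last, hk]; rfl
  refine ⟨(List.ofFn fun i : Fin (k + 1) => (ψ ^ (i : ℕ)) y : List Y), ?_, ?_, ?_, ?_⟩
  · rw [Ne, Cycle.coe_eq_nil]
    exact fun e => by simpa using congrArg List.length e
  · rw [Cycle.nodup_coe_iff, List.nodup_ofFn]
    have key : ∀ i j : Fin (k + 1), i < j → (ψ ^ (i : ℕ)) y ≠ (ψ ^ (j : ℕ)) y := by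
      intro i j hij e
      have hij' : (i : ℕ) < j := hij
      apply hmin ((j : ℕ) - i - 1) (by omega)
      apply (ψ ^ (i : ℕ)).injective
      rw [e, ← mul_apply, ← pow_add]
      congr 2
      omega
    intro i j e
    rcases lt_trichotomy i j with hij | hij | hij
    · exact absurd e (key i j hij)
    · exact hij
    · exact absurd e.symm (key j i hij)
  · rw [Cycle.chain_ofFn]
    exact hchain
  · intro g
    rw [Cycle.mem_coe_iff, List.mem_ofFn]
    constructor
    · rintro ⟨i, rfl⟩
      exact ⟨(i : ℕ), by rw [zpow_natCast]⟩
    · intro h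
      refine h.mem_of_invariant (S := {g | ∃ i : Fin (k + 1), (ψ ^ (i : ℕ)) y = g}) ?_ ⟨0, rfl⟩
      rintro _ ⟨i, rfl⟩
      exact ⟨i + 1, (hchain i).symm⟩

/-! ### Oriented embeddings: Euler's formula modulo two and genus. -/

namespace HGraph

variable {V H : Type*} {G : HGraph V H}

theorem edge_eq_iff {g h : H} : G.edge g = G.edge h ↔ g = h ∨ g = G.mate h := by
  unfold edge
  rw [Sym2.eq_iff]
  constructor
  · rintro (h | h)
    · exact Or.inl h.1
    · exact Or.inr h.1
  · rintro (rfl | rfl)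
    · exact Or.inl ⟨rfl, rfl⟩
    · exact Or.inr ⟨rfl, G.mate_mate h⟩

theorem edge_mate (h : H) : G.edge (G.mate h) = G.edge h := edge_eq_iff.2 (Or.inr rfl)

namespace OrientedEmbedding

variable (Φ : G.OrientedEmbedding)

theorem faceTrace_apply (h : H) : Φ.faceTrace h = Φ.rot (G.mate h) := rfl

theorem faceOf_eq_iff {g h : H} : Φ.faceOf g = Φ.faceOf h ↔ Φ.faceTrace.SameCycle g h :=
  ⟨fun e => Quotient.exact e, fun e => Quotient.sound e⟩

theorem exists_faceOf_eq (f : Φ.Face) : ∃ h, Φ.faceOf h = f := Quotient.exists_rep f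

instance [Finite H] : Finite Φ.Face :=
  inferInstanceAs (Finite (Quotient (Equiv.Perm.SameCycle.setoid Φ.faceTrace)))

theorem card_face : Nat.card Φ.Face = orbitCount Φ.faceTrace := rfl

theorem orbitCount_rot [Finite V] [Finite H] (hinc : Function.Surjective G.inc) :
    orbitCount Φ.rot = Nat.card V := by
  have hF : ∀ a b, Φ.rot.SameCycle a b → G.inc a = G.inc b := fun a b hab =>
    (hab.apply_eq_of_invariant Φ.inc_rot).symm
  refine Nat.card_eq_of_bijective (Quotient.lift (s := SameCycle.setoid Φ.rot) G.inc hF) ⟨?_, ?_⟩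
  · intro p q e
    induction p using Quotient.inductionOn with | _ a =>
    induction q using Quotient.inductionOn with | _ b =>
    exact Quotient.sound (Φ.sameCycle_of_inc_eq a b e)
  · intro x
    obtain ⟨h, rfl⟩ := hinc x
    exact ⟨Quotient.mk _ h, rfl⟩

theorem _root_.HGraph.orbitCount_matePerm [Finite H] :
    orbitCount G.matePerm = G.edgeSet.ncard := by
  have hF : ∀ a b, G.matePerm.SameCycle a b →
      (⟨G.edge a, a, rfl⟩ : G.edgeSet) = ⟨G.edge b, b, rfl⟩ := fun a b hab =>
    Subtype.ext (hab.apply_eq_of_invariant (F := G.edge) edge_mate).symm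
  refine Nat.card_eq_of_bijective (Quotient.lift (s := SameCycle.setoid G.matePerm)
    (fun h => (⟨G.edge h, h, rfl⟩ : G.edgeSet)) hF) ⟨?_, ?_⟩
  · intro p q e
    induction p using Quotient.inductionOn with | _ a =>
    induction q using Quotient.inductionOn with | _ b =>
    apply Quotient.sound
    rcases edge_eq_iff.1 (Subtype.ext_iff.1 e) with h | h
    · exact h.sameCycle _
    · subst h
      exact (sameCycle_apply_left (f := G.matePerm)).2 (SameCycle.refl _ _)
  · rintro ⟨_, h, rfl⟩
    exact ⟨Quotient.mk _ h, rfl⟩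

/-- Euler's formula modulo two. -/
theorem even_card_add_card_face [Fintype V] [Fintype H] (hinc : Function.Surjective G.inc)
    (hH : Even (Fintype.card H)) :
    Even (Fintype.card V + G.edgeSet.ncard + Nat.card Φ.Face) := by
  classical
  -- The orbits of the three permutations are the faces, the vertices and the edges, so comparing
  -- signs compares their numbers modulo two.
  have h1 : Φ.faceTrace = Φ.rot * G.matePerm := rfl
  have h2 := congrArg sign h1
  rw [Perm.sign_mul, sign_eq_pow_orbitCount, sign_eq_pow_orbitCount, sign_eq_pow_orbitCount,
    Φ.orbitCount_rot hinc, orbitCount_matePerm, ← card_face,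
    Nat.card_eq_fintype_card (α := V), ← pow_add] at h2
  have h3 : ∀ a b : ℕ, (-1 : ℤˣ) ^ a = (-1) ^ b → (Even a ↔ Even b) := by
    intro a b hab
    rw [← neg_one_pow_eq_one_iff_even (R := ℤˣ) (by decide), hab,
      neg_one_pow_eq_one_iff_even (by decide)]
  have h4 := h3 _ _ h2
  simp only [Nat.even_add] at h4 ⊢
  tauto

theorem genus_le_genus_iff {Ψ Φ : G.OrientedEmbedding} :
    Ψ.genus ≤ Φ.genus ↔ Nat.card Φ.Face ≤ Nat.card Ψ.Face := by
  unfold genus eulerGenus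
  rw [div_le_div_iff_of_pos_right (by norm_num)]
  rw [Int.cast_le]
  omega

theorem IsTwoFaceColorable.one_lt_card [Finite H] [Nonempty H] {Ψ : G.OrientedEmbedding}
    (h : Ψ.IsTwoFaceColorable) : 1 < Nat.card Ψ.Face := by
  obtain ⟨col, hcol⟩ := h
  have h0 := Classical.arbitrary H
  rw [Finite.one_lt_card_iff_nontrivial]
  exact ⟨_, _, fun e => hcol h0 (congrArg col e)⟩

end OrientedEmbedding

/-! ### From permutations of the visits to embeddings. -/

/-- The half-edges `out x`, in the cyclic order given by `c`, are those along which an euler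
circuit leaves the vertices. -/
structure IsEulerTour {X : Type*} (G : HGraph V H) (c : Perm X) (out : X → H) : Prop where
  sameCycle : ∀ x y, c.SameCycle x y
  inc_mate : ∀ x, G.inc (G.mate (out x)) = G.inc (out (c x))
  edge_injective : Function.Injective fun x => G.edge (out x)
  exists_eq : ∀ h, ∃ x, h = out x ∨ h = G.mate (out x)
  exists_inc : ∀ p, ∃ x, G.inc (out x) = p

theorem IsEulerCircuit.exists_isEulerTour [Nonempty V] {T : Cycle H}
    (hT : G.IsEulerCircuit T) :
    ∃ (k : ℕ) (out : Fin (k + 1) → H), T = (List.ofFn out : List H) ∧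
      G.IsEulerTour (Equiv.addRight 1) out := by
  induction T using Quotient.inductionOn with | _ l =>
  obtain ⟨⟨hwalk, hnodup⟩, hedge, hvert⟩ := hT
  obtain ⟨k, hk⟩ : ∃ k, l.length = k + 1 := by
    obtain ⟨g, hg, -⟩ := hvert (Classical.arbitrary V)
    have hg' : g ∈ l := hg
    exact Nat.exists_eq_succ_of_ne_zero (List.length_pos_of_mem hg').ne'
  obtain ⟨out, hout⟩ : ∃ out : Fin (k + 1) → H, l = List.ofFn out := by
    refine ⟨fun i => l.get (i.cast hk.symm), List.ext_getElem (by simp [hk]) fun i h1 h2 => ?_⟩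
    rw [List.getElem_ofFn]
    rfl
  subst hout
  change Cycle.Chain _ (List.ofFn out : Cycle H) at hwalk
  change (Cycle.map G.edge (List.ofFn out : Cycle H)).Nodup at hnodup
  change ∀ e ∈ G.edgeSet, e ∈ Cycle.map G.edge (List.ofFn out : Cycle H) at hedge
  change ∀ p, ∃ g ∈ (List.ofFn out : Cycle H), _ at hvert
  rw [Cycle.map_coe, Cycle.nodup_coe_iff, List.map_ofFn, List.nodup_ofFn] at hnodup
  rw [Cycle.chain_ofFn] at hwalk
  refine ⟨k, out, rfl, ?_, hwalk, hnodup, fun h => ?_, fun p => ?_⟩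
  · have h0 : ∀ x : Fin (k + 1), (Equiv.addRight (1 : Fin (k + 1))).SameCycle 0 x := by
      intro x
      induction x using Fin.induction with
      | zero => exact SameCycle.refl _ _
      | succ i ih =>
        have : (Equiv.addRight 1) i.castSucc = i.succ := Fin.coeSucc_eq_succ
        rw [← this]
        exact sameCycle_apply_right.2 ih
    exact fun x y => (h0 x).symm.trans (h0 y)
  · have := hedge (G.edge h) ⟨h, rfl⟩
    rw [Cycle.map_coe, Cycle.mem_coe_iff, List.map_ofFn, List.mem_ofFn] at this
    obtain ⟨i, hi⟩ := this
    exact ⟨i, edge_eq_iff.1 hi.symm⟩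
  · obtain ⟨g, hg, hgp⟩ := hvert p
    rw [Cycle.mem_coe_iff, List.mem_ofFn] at hg
    obtain ⟨i, rfl⟩ := hg
    exact ⟨i, hgp⟩

namespace IsEulerTour

variable {X : Type*} {c : Perm X} {out : X → H} (t : G.IsEulerTour c out)
include t

theorem out_injective : Function.Injective out := fun _ _ e =>
  t.edge_injective (congrArg G.edge e)

theorem out_ne_mate (x y : X) : out x ≠ G.mate (out y) := fun e => by
  have h := t.edge_injective (show G.edge (out x) = G.edge (out y) by rw [e, edge_mate])
  rw [h] at e
  exact G.mate_ne _ e.symm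

/-- The half-edges along which the circuit leaves and reaches the visits. -/
noncomputable def halfEdgeEquiv : X ⊕ X ≃ H :=
  Equiv.ofBijective (Sum.elim out fun x => G.mate (out (c⁻¹ x))) (by
    have hmate : Function.Injective G.mate :=
      Function.LeftInverse.injective G.mate_mate
    constructor
    · rintro (x | x) (y | y) e
      · exact congrArg _ (t.out_injective e)
      · exact absurd e (t.out_ne_mate _ _)
      · exact absurd e.symm (t.out_ne_mate _ _)
      · exact congrArg _ (c⁻¹.injective (t.out_injective (hmate e)))
    · intro h
      obtain ⟨x, rfl | rfl⟩ := t.exists_eq h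
      · exact ⟨Sum.inl x, rfl⟩
      · exact ⟨Sum.inr (c x), congrArg (fun y => G.mate (out y)) (c.symm_apply_apply x)⟩)

theorem even_card [Fintype X] [Fintype H] : Even (Fintype.card H) := by
  rw [← Fintype.card_congr t.halfEdgeEquiv, Fintype.card_sum]
  exact ⟨_, rfl⟩

theorem inc_mate_inv (x : X) : G.inc (G.mate (out (c⁻¹ x))) = G.inc (out x) := by
  rw [t.inc_mate, show c (c⁻¹ x) = x from c.apply_symm_apply x]

/-- The rotation alternates: the half-edge leaving at `x` is followed by the one arriving at `σ x`,
and that by the one leaving at `σ x`. Hence arriving and going on along the circuit is a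
face-tracing step. -/
theorem exists_embedding [Finite X] {σ : Perm X} (hσ : ∀ x, G.inc (out (σ x)) = G.inc (out x))
    (hσ' : ∀ x y, G.inc (out x) = G.inc (out y) → σ.SameCycle x y) :
    ∃ Φ : G.OrientedEmbedding, (∀ x, Φ.faceTrace (out x) = out (c x)) ∧
      ∀ x, Φ.faceTrace (G.mate (out (c⁻¹ x))) = G.mate (out (c⁻¹ ((σ * c⁻¹) x))) := by
  let ρ : Perm (X ⊕ X) := (Equiv.sumCongr σ (Equiv.refl X)).trans (Equiv.sumComm X X)
  let rot : Perm H := t.halfEdgeEquiv.permCongr ρ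
  have hl : ∀ x, t.halfEdgeEquiv (Sum.inl x) = out x := fun x => rfl
  have hr : ∀ x, t.halfEdgeEquiv (Sum.inr x) = G.mate (out (c⁻¹ x)) := fun x => rfl
  have hrl : ∀ x, rot (out x) = G.mate (out (c⁻¹ (σ x))) := fun x => by
    rw [← hl, Equiv.permCongr_apply, Equiv.symm_apply_apply]
    exact hr _
  have hrr : ∀ x, rot (G.mate (out (c⁻¹ x))) = out x := fun x => by
    rw [← hr, Equiv.permCongr_apply, Equiv.symm_apply_apply]
    exact hl _
  have hrm : ∀ x, rot (G.mate (out x)) = out (c x) := fun x => by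
    have := hrr (c x)
    rwa [show c⁻¹ (c x) = x from c.symm_apply_apply x] at this
  have hsame : ∀ h, ∃ x, rot.SameCycle h (out x) ∧ G.inc h = G.inc (out x) := by
    intro h
    obtain ⟨x, rfl | rfl⟩ := t.exists_eq h
    · exact ⟨x, SameCycle.refl _ _, rfl⟩
    · refine ⟨c x, ?_, t.inc_mate x⟩
      rw [← hrm]
      exact sameCycle_apply_right.2 (SameCycle.refl _ _)
  refine ⟨⟨rot, fun h => ?_, fun g h hgh => ?_⟩, fun x => ?_, fun x => ?_⟩
  · obtain ⟨x, rfl | rfl⟩ := t.exists_eq h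
    · rw [hrl, t.inc_mate_inv, hσ]
    · rw [hrm, t.inc_mate]
  · obtain ⟨x, hx, hx'⟩ := hsame g
    obtain ⟨y, hy, hy'⟩ := hsame h
    refine hx.trans (SameCycle.trans ?_ hy.symm)
    -- Two rotation steps take `out x` to `out (σ x)`, so an orbit of `σ` lands in one orbit of
    -- `rot`.
    have := (hσ' x y (by rw [← hx', hgh, hy'])).map (ψ := rot ^ 2) (f := out) (fun x => by
      rw [pow_two, mul_apply, hrl, hrr])
    exact this.of_pow
  · exact hrm x
  · rw [OrientedEmbedding.faceTrace_apply, G.mate_mate]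
    exact hrl _

theorem sameCycle_faceTrace_iff [Finite X] [Finite H] {Φ : G.OrientedEmbedding} {φ : Perm X}
    (hin : ∀ x, Φ.faceTrace (G.mate (out (c⁻¹ x))) = G.mate (out (c⁻¹ (φ x)))) {x y : X} :
    Φ.faceTrace.SameCycle (G.mate (out (c⁻¹ x))) (G.mate (out (c⁻¹ y))) ↔ φ.SameCycle x y :=
  sameCycle_map_iff (f := fun x => G.mate (out (c⁻¹ x)))
    ((Function.LeftInverse.injective G.mate_mate).comp (t.out_injective.comp c⁻¹.injective)) hin

variable {Φ : G.OrientedEmbedding} (hout : ∀ x, Φ.faceTrace (out x) = out (c x))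
include hout

theorem faceOf_out_eq [Finite X] (x y : X) : Φ.faceOf (out x) = Φ.faceOf (out y) :=
  Φ.faceOf_eq_iff.2 ((t.sameCycle x y).map hout)

theorem faceOf_mate_ne [Finite H] (x y : X) : Φ.faceOf (G.mate (out x)) ≠ Φ.faceOf (out y) := by
  intro e
  have := (Φ.faceOf_eq_iff.1 e.symm).mem_of_invariant (S := Set.range out) (by
    rintro _ ⟨z, rfl⟩
    exact ⟨c z, (hout z).symm⟩) ⟨y, rfl⟩
  obtain ⟨z, hz⟩ := this
  exact t.out_ne_mate _ _ hz

theorem exists_faceOf_mate {x₀ : X} [Finite X] (f : Φ.Face) (hf : f ≠ Φ.faceOf (out x₀)) :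
    ∃ x, Φ.faceOf (G.mate (out (c⁻¹ x))) = f := by
  obtain ⟨h, rfl⟩ := Φ.exists_faceOf_eq f
  obtain ⟨x, rfl | rfl⟩ := t.exists_eq h
  · exact absurd (t.faceOf_out_eq hout _ _) hf
  · exact ⟨c x, by rw [show c⁻¹ (c x) = x from c.symm_apply_apply x]⟩

variable {φ : Perm X}
  (hin : ∀ x, Φ.faceTrace (G.mate (out (c⁻¹ x))) = G.mate (out (c⁻¹ (φ x))))
include hin

theorem card_faces_ne [Finite X] [Finite H] (x₀ : X) :
    Nat.card {f : Φ.Face // f ≠ Φ.faceOf (out x₀)} = orbitCount φ := by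
  have hwd : ∀ a b, φ.SameCycle a b →
      (⟨Φ.faceOf (G.mate (out (c⁻¹ a))), t.faceOf_mate_ne hout _ _⟩ :
        {f : Φ.Face // f ≠ Φ.faceOf (out x₀)}) =
      ⟨Φ.faceOf (G.mate (out (c⁻¹ b))), t.faceOf_mate_ne hout _ _⟩ := fun a b hab =>
    Subtype.ext (Φ.faceOf_eq_iff.2 ((t.sameCycle_faceTrace_iff hin).2 hab))
  refine (Nat.card_eq_of_bijective (Quotient.lift (s := SameCycle.setoid φ) _ hwd) ⟨?_, ?_⟩).symm
  · intro p q e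
    induction p using Quotient.inductionOn with | _ a =>
    induction q using Quotient.inductionOn with | _ b =>
    exact Quotient.sound ((t.sameCycle_faceTrace_iff hin).1
      (Φ.faceOf_eq_iff.1 (Subtype.ext_iff.1 e)))
  · rintro ⟨f, hf⟩
    obtain ⟨x, hx⟩ := t.exists_faceOf_mate hout f hf
    exact ⟨Quotient.mk _ x, Subtype.ext hx⟩

theorem card_face [Finite X] [Finite H] (x₀ : X) : Nat.card Φ.Face = orbitCount φ + 1 := by
  rw [← t.card_faces_ne hout hin x₀]
  have := Set.ncard_add_ncard_compl {Φ.faceOf (out x₀)}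
  rw [Set.ncard_singleton] at this
  rw [← this, add_comm]
  rfl

/-- If the other side is a single face then that face is bounded by an euler circuit. -/
theorem exists_isFacialWalk [Finite X] [Finite H] (hφ : orbitCount φ ≤ 1) (x : X) :
    ∃ C, Φ.IsFacialWalk (Φ.faceOf (G.mate (out (c⁻¹ x)))) C ∧ G.IsEulerCircuit C := by
  obtain ⟨C, hne, hnd, hch, hmem⟩ := exists_cycle_of_orbit Φ.faceTrace (G.mate (out (c⁻¹ x)))
  have hall : ∀ y, G.mate (out y) ∈ C := fun y => by
    have := (t.sameCycle_faceTrace_iff hin).2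
      (sameCycle_of_orbitCount_le_one hφ x (c y))
    rw [show c⁻¹ (c y) = y from c.symm_apply_apply y] at this
    exact (hmem _).2 this
  have honly : ∀ h ∈ C, ∃ y, h = G.mate (out y) := fun h hh => by
    obtain ⟨y, rfl | rfl⟩ := t.exists_eq h
    · exact absurd (Φ.faceOf_eq_iff.2 ((hmem _).1 hh)) (t.faceOf_mate_ne hout _ _)
    · exact ⟨y, rfl⟩
  refine ⟨C, ⟨hne, hnd, hch, fun h hh => (Φ.faceOf_eq_iff.2 ((hmem h).1 hh)).symm⟩,
    ⟨?_, ?_⟩, ?_, ?_⟩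
  · refine Cycle.chain_mono (fun g g' hgg => ?_) C hch
    rw [← hgg, OrientedEmbedding.faceTrace_apply, Φ.inc_rot]
  · induction C using Quotient.inductionOn with | _ l =>
    change (l.map G.edge).Nodup
    have hl : l.Nodup := hnd
    refine hl.map_on fun g hg g' hg' e => ?_
    obtain ⟨y, rfl⟩ := honly g hg
    obtain ⟨y', rfl⟩ := honly g' hg'
    rw [edge_mate, edge_mate] at e
    rw [t.edge_injective e]
  · rintro _ ⟨h, rfl⟩
    rw [Cycle.mem_map]
    obtain ⟨y, rfl | rfl⟩ := t.exists_eq h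
    · exact ⟨_, hall y, edge_mate _⟩
    · exact ⟨_, hall y, rfl⟩
  · intro p
    obtain ⟨y, rfl⟩ := t.exists_inc p
    exact ⟨_, hall (c⁻¹ y), t.inc_mate_inv y⟩

end IsEulerTour

end HGraph

end

/-! ### The main theorem. -/

theorem corollary4p5 {V H : Type*} [Fintype V] [Fintype H] (G : HGraph V H)
    [DecidableRel G.underlyingSimple.Adj]
    (hdeg : (4 * (Fintype.card V : ℚ) + 2) / 5 ≤ (G.underlyingSimple.minDegree : ℚ))
    (T : Cycle H) (hT : G.IsEulerCircuit T) :
    ∃ Φ : G.OrientedEmbedding,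
      (∃ col : Φ.Face → Bool, Φ.IsProperFaceColoring col ∧
        (∃ f₀ : Φ.Face, Φ.IsFacialWalk f₀ T ∧ ∀ f, col f = true ↔ f = f₀) ∧
        Nat.card {f : Φ.Face // col f = false} =
          if Even (Fintype.card V + G.edgeSet.ncard) then 1 else 2) ∧
      (∀ Ψ : G.OrientedEmbedding, Ψ.IsTwoFaceColorable → Ψ.genus ≤ Φ.genus) ∧
      (Even (Fintype.card V + G.edgeSet.ncard) →
        Φ.IsBiEulerian ∧ ∀ Ψ : G.OrientedEmbedding, Ψ.genus ≤ Φ.genus) := by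
  classical
  have hdeg' : 4 * Fintype.card V + 2 ≤ 5 * G.underlyingSimple.minDegree := by
    rw [div_le_iff₀ (by norm_num)] at hdeg
    have : (4 * (Fintype.card V : ℚ) + 2) ≤ 5 * (G.underlyingSimple.minDegree : ℚ) := by linarith
    exact_mod_cast this
  -- An empty graph has minimum degree `0` by convention, which violates the bound.
  have hV : Nonempty V := by
    by_contra hV
    rw [not_nonempty_iff] at hV
    have := G.underlyingSimple.minDegree_of_subsingleton
    omega
  obtain ⟨k, out, rfl, t⟩ := hT.exists_isEulerTour
  have hinc : Function.Surjective G.inc := fun p => by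
    obtain ⟨x, hx⟩ := t.exists_inc p
    exact ⟨_, hx⟩
  have : Nonempty H := ⟨out 0⟩
  obtain ⟨σ, hσ, hσ', hle⟩ := exists_rotation_of_minDegree (v := fun x => G.inc (out x))
    t.sameCycle G.underlyingSimple (by
      rintro _ _ ⟨-, h, rfl, rfl⟩
      obtain ⟨x, rfl | rfl⟩ := t.exists_eq h
      · exact ⟨x, Or.inl ⟨rfl, (t.inc_mate x).symm⟩⟩
      · exact ⟨x, Or.inr ⟨by rw [G.mate_mate], (t.inc_mate x).symm⟩⟩) hdeg'
  obtain ⟨Φ, hout, hin⟩ := t.exists_embedding hσ hσ'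
  have hcard := t.card_face hout hin 0
  have hpar := fun Ψ : G.OrientedEmbedding => Ψ.even_card_add_card_face hinc t.even_card
  have hpos := Equiv.Perm.orbitCount_pos (σ * (Equiv.addRight (1 : Fin (k + 1)))⁻¹)
  -- The count is one or two, and parity decides which.
  have hΦ : Equiv.Perm.orbitCount (σ * (Equiv.addRight (1 : Fin (k + 1)))⁻¹) =
      if Even (Fintype.card V + G.edgeSet.ncard) then 1 else 2 := by
    have h1 := hpar Φ
    rw [hcard, Nat.even_add] at h1
    split_ifs with he
    · have := h1.1 he
      interval_cases Equiv.Perm.orbitCount (σ * (Equiv.addRight (1 : Fin (k + 1)))⁻¹)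
      · rfl
      · exact absurd this (by decide)
    · have : ¬ Even _ := fun e => he (h1.2 e)
      interval_cases Equiv.Perm.orbitCount (σ * (Equiv.addRight (1 : Fin (k + 1)))⁻¹)
      · exact absurd (by decide) this
      · rfl
  have hwalk : Φ.IsFacialWalk (Φ.faceOf (out 0)) (List.ofFn out : List H) := by
    refine ⟨?_, ?_, ?_, fun h hh => ?_⟩
    · rw [Ne, Cycle.coe_eq_nil]
      exact fun e => by simpa using congrArg List.length e
    · rw [Cycle.nodup_coe_iff, List.nodup_ofFn]
      exact t.out_injective
    · rw [Cycle.chain_ofFn]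
      exact hout
    · rw [Cycle.mem_coe_iff, List.mem_ofFn] at hh
      obtain ⟨i, rfl⟩ := hh
      exact t.faceOf_out_eq hout _ _
  refine ⟨Φ, ⟨fun f => decide (f = Φ.faceOf (out 0)), fun h => ?_,
    ⟨Φ.faceOf (out 0), hwalk, fun f => decide_eq_true_iff⟩, ?_⟩, fun Ψ hΨ => ?_, fun he => ⟨⟨?_, ?_⟩,
      fun Ψ => ?_⟩⟩
  · beta_reduce
    obtain ⟨x, rfl | rfl⟩ := t.exists_eq h
    · rw [decide_eq_true (t.faceOf_out_eq hout _ _),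
        decide_eq_false (t.faceOf_mate_ne hout _ _)]
      exact Bool.noConfusion
    · rw [G.mate_mate, decide_eq_true (t.faceOf_out_eq hout _ _),
        decide_eq_false (t.faceOf_mate_ne hout _ _)]
      exact Bool.noConfusion
  · simp only [decide_eq_false_iff_not]
    rw [← hΦ]
    exact t.card_faces_ne hout hin 0
  · rw [HGraph.OrientedEmbedding.genus_le_genus_iff, hcard, hΦ]
    have h1 := hΨ.one_lt_card
    have h2 := hpar Ψ
    split_ifs with he
    · exact h1
    -- Two colors need at least two faces, and the odd case rules out exactly two.
    · have h3 : Nat.card Ψ.Face ≠ 2 := fun e => by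
        rw [e, Nat.even_add] at h2
        exact he (h2.2 (by decide))
      omega
  · rw [hcard, hΦ, if_pos he]
  · intro f
    by_cases hf : f = Φ.faceOf (out 0)
    · exact ⟨_, hf ▸ hwalk, hT⟩
    · obtain ⟨x, rfl⟩ := t.exists_faceOf_mate hout f hf
      exact t.exists_isFacialWalk hout hin (by rw [hΦ, if_pos he]) x
  · rw [HGraph.OrientedEmbedding.genus_le_genus_iff, hcard, hΦ, if_pos he]
    have h2 := hpar Ψ
    rw [Nat.even_add] at h2
    have h3 := h2.1 he
    have : Nonempty Ψ.Face := ⟨Ψ.faceOf (out 0)⟩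
    have h4 : 0 < Nat.card Ψ.Face := Nat.card_pos
    obtain ⟨m, hm⟩ := h3
    omega
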